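/- Let $a,b,c$ be real numbers with $c\notin\mathbb Z$ and $c-a-b\notin\mathbb Z$. Consider the equation $$\partial_z^2 T(z)+\frac{c-z(a+b+1)}{z(1-z)}\,\partial_z T(z)-\frac{ab}{z(1-z)}\,T(z)=0,\qquad z\in\mathbb C\setminus\{0,1\},\qquad (\ast)$$ for real-valued functions $T$ of class $C^2$ on $\mathbb C\setminus\{0,1\}$, where $z=x+iy$ and $\partial_z=\frac12(\partial_x-i\partial_y)$. Let $$F_-(z)={}_2F_1(a,b,c,z),\qquad F_+(z)=z^{1-c}\,{}_2F_1(1+a-c,1+b-c,2-c,z),$$ where ${}_2F_1$ denotes the holomorphic continuation of the Gauss hypergeometric series from the unit disc to $\mathbb C\setminus[1,\infty)$ and $z^{1-c}$ is the principal branch. Then every real-valued solution $T$ of $(\ast)$ on $\mathbb C\setminus\{0,1\}$ can be written as $$T(z)=\lambda_1|F_-(z)|^2+\lambda_2|F_+(z)|^2$$ with real numbers $\lambda_1,\lambda_2$ satisfying $$\lambda_1\,\frac{\Gamma(c)^2}{\Gamma(c-a)\Gamma(c-b)\Gamma(a)\Gamma(b)}+\lambda_2\,\frac{\Gamma(2-c)^2}{\Gamma(1-a)\Gamma(1-b)\Gamma(a-c+1)\Gamma(b-c+1)}=0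 ,$$ where $1/\Gamma$ is understood to be $0$ at the poles of $\Gamma$; the formula for $T$ holds at every $z\in\mathbb C\setminus\{0,1\}$ off the cut $(1,\infty)$, and at the points of the cut it holds in the sense of limits from $\mathbb C\setminus[1,\infty)$. In particular, if at least one of the two coefficients in front of $\lambda_1,\lambda_2$ is nonzero, then the real vector space of real-valued solutions of $(\ast)$ on $\mathbb C\setminus\{0,1\}$ has dimension exactly one. -/

import Mathlib

namespace HypergeoPDE

noncomputable section

/-- The domain `ℂ ∖ {0, 1}`. -/
def puncturedPlane : Set ℂ := {0, 1}ᶜ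

/-- The cut plane `ℂ ∖ [1, ∞)`. -/
def cutPlane : Set ℂ := {z : ℂ | ¬ (z.im = 0 ∧ 1 ≤ z.re)}

/-- The Wirtinger derivative `∂_z f = (∂_x f - i ∂_y f) / 2` of a function of `z = x + i y`. -/
def dz (f : ℂ → ℂ) (z : ℂ) : ℂ :=
  (fderiv ℝ f z 1 - Complex.I * fderiv ℝ f z Complex.I) / 2

/-- `T` is a real-valued classical (`C²`) solution on `ℂ ∖ {0, 1}` of
`∂_z² T + (c - z (a + b + 1)) / (z (1 - z)) ∂_z T - a b / (z (1 - z)) T = 0`. The values of `T`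
at `0` and `1` play no role. -/
def IsSolution (a b c : ℝ) (T : ℂ → ℝ) : Prop :=
  ContDiffOn ℝ 2 T puncturedPlane ∧
  ∀ z ∈ puncturedPlane,
    dz (dz (fun w => (T w : ℂ))) z
      + ((c : ℂ) - z * ((a : ℂ) + (b : ℂ) + 1)) / (z * (1 - z)) * dz (fun w => (T w : ℂ)) z
      - ((a : ℂ) * (b : ℂ)) / (z * (1 - z)) * (T z : ℂ) = 0

/-- `F` is holomorphic on `ℂ ∖ [1, ∞)` and is given on the open unit disc by the Gauss
hypergeometric series with parameters `a, b, c`. -/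
def IsContinuation (a b c : ℝ) (F : ℂ → ℂ) : Prop :=
  DifferentiableOn ℂ F cutPlane ∧
  ∀ z : ℂ, ‖z‖ < 1 → F z = ordinaryHypergeometric (a : ℂ) (b : ℂ) (c : ℂ) z

open Classical in
/-- The Gauss hypergeometric function `₂F₁(a, b, c, ·)` on `ℂ ∖ [1, ∞)`: the holomorphic
continuation of the hypergeometric series to this (connected) set, which is unique there. -/
def gauss2F1 (a b c : ℝ) (z : ℂ) : ℂ :=
  if h : ∃ F : ℂ → ℂ, IsContinuation a b c F then h.choose z else 0

/-- `F₋(z) = ₂F₁(a, b, c, z)`. -/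
def Fminus (a b c : ℝ) (z : ℂ) : ℂ := gauss2F1 a b c z

/-- `F₊(z) = z^(1-c) ₂F₁(1 + a - c, 1 + b - c, 2 - c, z)`, with the principal branch of the
power. -/
def Fplus (a b c : ℝ) (z : ℂ) : ℂ :=
  z ^ (1 - (c : ℂ)) * gauss2F1 (1 + a - c) (1 + b - c) (2 - c) z

/-- The function `λ₁ |F₋|² + λ₂ |F₊|²`. -/
def combination (a b c l₁ l₂ : ℝ) (z : ℂ) : ℝ :=
  l₁ * ‖Fminus a b c z‖ ^ 2 + l₂ * ‖Fplus a b c z‖ ^ 2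

/-- `T = λ₁ |F₋|² + λ₂ |F₊|²` on `ℂ ∖ {0, 1}`: equality at every point off the cut `(1, ∞)` of
`F₋, F₊`, and on that cut `T` is the limit of the right-hand side from off the cut. -/
def HasForm (a b c l₁ l₂ : ℝ) (T : ℂ → ℝ) : Prop :=
  (∀ z ∈ puncturedPlane ∩ cutPlane, T z = combination a b c l₁ l₂ z) ∧
  ∀ x : ℝ, 1 < x →
    Filter.Tendsto (combination a b c l₁ l₂) (nhdsWithin (x : ℂ) cutPlane) (nhds (T x))

/-- The coefficient of `λ₁`. Mathlib's `Real.Gamma` is `0` at the poles of `Γ` and `x / 0 = 0`,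
so that `1 / Γ` is `0` at these poles, as usual. -/
def coeffMinus (a b c : ℝ) : ℝ :=
  Real.Gamma c ^ 2 /
    (Real.Gamma (c - a) * Real.Gamma (c - b) * Real.Gamma a * Real.Gamma b)

/-- The coefficient of `λ₂`, with the same convention. -/
def coeffPlus (a b c : ℝ) : ℝ :=
  Real.Gamma (2 - c) ^ 2 /
    (Real.Gamma (1 - a) * Real.Gamma (1 - b) * Real.Gamma (a - c + 1) * Real.Gamma (b - c + 1))

theorem isOpen_puncturedPlane : IsOpen puncturedPlane :=
  (Set.toFinite ({0, 1} : Set ℂ)).isClosed.isOpen_compl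

theorem dz_add {f g : ℂ → ℂ} {z : ℂ} (hf : DifferentiableAt ℝ f z)
    (hg : DifferentiableAt ℝ g z) : dz (fun w => f w + g w) z = dz f z + dz g z := by
  unfold dz
  rw [fderiv_fun_add hf hg]
  simp only [add_apply]
  ring

theorem dz_const_mul {f : ℂ → ℂ} {z : ℂ} (k : ℂ) (hf : DifferentiableAt ℝ f z) :
    dz (fun w => k * f w) z = k * dz f z := by
  unfold dz
  rw [fderiv_const_mul hf]
  simp only [smul_apply, smul_eq_mul]
  ring

theorem dz_congr {f g : ℂ → ℂ} {z : ℂ} (h : f =ᶠ[nhds z] g) : dz f z = dz g z := by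
  unfold dz
  rw [h.fderiv_eq]

theorem contDiffAt_ofReal {T : ℂ → ℝ} (hT : ContDiffOn ℝ 2 T puncturedPlane) {z : ℂ}
    (hz : z ∈ puncturedPlane) : ContDiffAt ℝ 2 (fun w => (T w : ℂ)) z :=
  Complex.ofRealCLM.contDiff.contDiffAt.comp z
    (hT.contDiffAt (isOpen_puncturedPlane.mem_nhds hz))

theorem differentiableAt_ofReal {T : ℂ → ℝ} (hT : ContDiffOn ℝ 2 T puncturedPlane) {z : ℂ}
    (hz : z ∈ puncturedPlane) : DifferentiableAt ℝ (fun w => (T w : ℂ)) z :=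
  (contDiffAt_ofReal hT hz).differentiableAt (by norm_num)

theorem differentiableAt_dz_ofReal {T : ℂ → ℝ} (hT : ContDiffOn ℝ 2 T puncturedPlane) {z : ℂ}
    (hz : z ∈ puncturedPlane) : DifferentiableAt ℝ (dz (fun w => (T w : ℂ))) z := by
  have h : DifferentiableAt ℝ (fderiv ℝ (fun w => (T w : ℂ))) z :=
    ((contDiffAt_ofReal hT hz).fderiv_right (m := 1) (by norm_num)).differentiableAt
      (by norm_num)
  unfold dz
  simp only [div_eq_mul_inv]
  exact ((h.clm_apply (differentiableAt_const _)).sub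
    ((h.clm_apply (differentiableAt_const _)).const_mul _)).mul_const _

theorem IsSolution.add {a b c : ℝ} {S T : ℂ → ℝ} (hS : IsSolution a b c S)
    (hT : IsSolution a b c T) : IsSolution a b c (S + T) := by
  refine ⟨hS.1.add hT.1, fun z hz => ?_⟩
  have e : ∀ w ∈ puncturedPlane, dz (fun w => ((S + T) w : ℂ)) w
      = dz (fun w => (S w : ℂ)) w + dz (fun w => (T w : ℂ)) w := fun w hw => by
    simpa only [Pi.add_apply, Complex.ofReal_add] using
      dz_add (differentiableAt_ofReal hS.1 hw) (differentiableAt_ofReal hT.1 hw)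
  have e2 := dz_congr (Filter.eventually_of_mem (isOpen_puncturedPlane.mem_nhds hz) e)
  rw [dz_add (differentiableAt_dz_ofReal hS.1 hz) (differentiableAt_dz_ofReal hT.1 hz)] at e2
  rw [e2, e z hz, Pi.add_apply, Complex.ofReal_add]
  linear_combination hS.2 z hz + hT.2 z hz

theorem IsSolution.smul {a b c : ℝ} {T : ℂ → ℝ} (k : ℝ) (hT : IsSolution a b c T) :
    IsSolution a b c (k • T) := by
  refine ⟨hT.1.const_smul k, fun z hz => ?_⟩
  have e : ∀ w ∈ puncturedPlane, dz (fun w => ((k • T) w : ℂ)) w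
      = (k : ℂ) * dz (fun w => (T w : ℂ)) w := fun w hw => by
    simpa only [Pi.smul_apply, smul_eq_mul, Complex.ofReal_mul] using
      dz_const_mul (k : ℂ) (differentiableAt_ofReal hT.1 hw)
  have e2 := dz_congr (Filter.eventually_of_mem (isOpen_puncturedPlane.mem_nhds hz) e)
  rw [dz_const_mul (k : ℂ) (differentiableAt_dz_ofReal hT.1 hz)] at e2
  rw [e2, e z hz, Pi.smul_apply, smul_eq_mul, Complex.ofReal_mul]
  linear_combination (k : ℂ) * hT.2 z hz

theorem isSolution_zero (a b c : ℝ) : IsSolution a b c 0 := by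
  refine ⟨contDiffOn_const, fun z _ => ?_⟩
  have e : dz (fun w => (((0 : ℂ → ℝ) w : ℝ) : ℂ)) = fun _ => 0 := by
    funext w
    simp [dz]
  rw [e]
  simp [dz]

/-- The real vector space of real-valued solutions on `ℂ ∖ {0, 1}`, as functions on that set. -/
def solutionSpace (a b c : ℝ) : Submodule ℝ (puncturedPlane → ℝ) where
  carrier := {u | ∃ T : ℂ → ℝ, IsSolution a b c T ∧ ∀ z : puncturedPlane, u z = T z}
  add_mem' := by
    rintro u v ⟨S, hS, hu⟩ ⟨T, hT, hv⟩
    exact ⟨S + T, hS.add hT, fun z => by simp [hu z, hv z]⟩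
  zero_mem' := ⟨0, isSolution_zero a b c, fun _ => rfl⟩
  smul_mem' := by
    rintro k u ⟨T, hT, hu⟩
    exact ⟨k • T, hT.smul k, fun z => by simp [hu z]⟩

end

end HypergeoPDE

/-!
Away from the singular points, a real solution of the equation in `∂_z` is a bilinear form in a
basis of local holomorphic solutions and their conjugates. Crossing `(0, 1)` is harmless for the
basis `F₋, F₊`, whereas the monodromy at `0` multiplies the two cross terms by non-trivial phases,
as `c ∉ ℤ`; hence only `|F₋|²` and `|F₊|²` survive. The same argument at `1`, in the variable
`1 - z` and with `c - a - b ∉ ℤ`, forbids the cross terms of the local solutions at `1`. Rewriting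
`λ₁ |F₋|² + λ₂ |F₊|²` by means of Gauss' connection formulas, the coefficient of these cross terms
is `Γ(c - a - b) Γ(a + b - c)` times the linear condition on `λ₁, λ₂`. Conversely, if the condition
holds, the expansions at `0` and at `1` glue to a solution on `ℂ ∖ {0, 1}`.
-/

namespace HypergeoPDE

open Filter Topology ComplexConjugate

noncomputable section

/-- The `n`-th Taylor coefficient of `f` at `0`. -/
def taylorCoeff (f : ℂ → ℂ) (n : ℕ) : ℂ := iteratedDeriv n f 0 / n.factorial

/-- The shifted Euler operator `θ + p`, where `θ = z d/dz`. It multiplies the `n`-th Taylor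
coefficient by `n + p`, so a recurrence for Taylor coefficients is a differential equation written
in terms of such operators. -/
def eulerOp (p : ℂ) (f : ℂ → ℂ) (z : ℂ) : ℂ := z * deriv f z + p * f z

section Taylor

variable {f g : ℂ → ℂ}

lemma taylorCoeff_zero (f : ℂ → ℂ) : taylorCoeff f 0 = f 0 := by
  simp [taylorCoeff]

lemma taylorCoeff_congr (h : f =ᶠ[𝓝 0] g) : taylorCoeff f = taylorCoeff g := by
  funext n
  rw [taylorCoeff, taylorCoeff, h.iteratedDeriv_eq]

lemma taylorCoeff_add (hf : AnalyticAt ℂ f 0) (hg : AnalyticAt ℂ g 0) (n : ℕ) :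
    taylorCoeff (fun z => f z + g z) n = taylorCoeff f n + taylorCoeff g n := by
  rw [taylorCoeff, iteratedDeriv_fun_add hf.contDiffAt hg.contDiffAt, add_div]
  rfl

lemma taylorCoeff_const_mul (k : ℂ) (f : ℂ → ℂ) (n : ℕ) :
    taylorCoeff (fun z => k * f z) n = k * taylorCoeff f n := by
  rw [taylorCoeff, iteratedDeriv_const_mul_field, mul_div_assoc]
  rfl

lemma taylorCoeff_eq_zero (h : ∀ᶠ z in 𝓝 0, f z = 0) (n : ℕ) : taylorCoeff f n = 0 := by
  rw [taylorCoeff_congr (g := fun _ => (0 : ℂ) * 0) (h.mono fun z hz => by simpa using hz),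
    taylorCoeff_const_mul, zero_mul]

lemma taylorCoeff_deriv (f : ℂ → ℂ) (n : ℕ) :
    taylorCoeff (deriv f) n = (n + 1) * taylorCoeff f (n + 1) := by
  have : (n : ℂ) + 1 ≠ 0 := by exact_mod_cast n.succ_ne_zero
  rw [taylorCoeff, taylorCoeff, ← iteratedDeriv_succ', Nat.factorial_succ]
  push_cast
  field_simp

lemma taylorCoeff_eq_coeff {p : FormalMultilinearSeries ℂ ℂ ℂ} (h : HasFPowerSeriesAt f p 0)
    (n : ℕ) : taylorCoeff f n = p.coeff n := by
  rw [← h.analyticAt.hasFPowerSeriesAt.eq_formalMultilinearSeries h,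
    FormalMultilinearSeries.coeff_ofScalars]
  rfl

lemma taylorCoeff_id_mul_succ (hf : AnalyticAt ℂ f 0) (n : ℕ) :
    taylorCoeff (fun z => z * f z) (n + 1) = taylorCoeff f n := by
  have hg : AnalyticAt ℂ (fun z => z * f z) 0 := by fun_prop
  have hp := hg.hasFPowerSeriesAt
  have hdslope : dslope (fun z => z * f z) 0 =ᶠ[𝓝 0] f := by
    refine Eventually.of_forall fun z => ?_
    rcases eq_or_ne z 0 with rfl | hz
    · rw [dslope_same, deriv_fun_mul differentiableAt_fun_id hf.differentiableAt]
      simp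
    · simpa using dslope_sub_smul_of_ne f hz
  rw [taylorCoeff_eq_coeff hp, ← FormalMultilinearSeries.coeff_fslope,
    ← taylorCoeff_eq_coeff (hp.has_fpower_series_dslope_fslope.congr hdslope)]

lemma analyticAt_eulerOp (p : ℂ) {z : ℂ} (hf : AnalyticAt ℂ f z) :
    AnalyticAt ℂ (eulerOp p f) z :=
  (analyticAt_id.mul hf.deriv).add (analyticAt_const.mul hf)

lemma taylorCoeff_eulerOp (p : ℂ) (hf : AnalyticAt ℂ f 0) (n : ℕ) :
    taylorCoeff (eulerOp p f) n = (n + p) * taylorCoeff f n := by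
  have hθ : taylorCoeff (fun z => z * deriv f z) n = n * taylorCoeff f n := by
    cases n with
    | zero => simp [taylorCoeff_zero]
    | succ n => exact_mod_cast (taylorCoeff_id_mul_succ hf.deriv n).trans (taylorCoeff_deriv f n)
  have := hf.deriv
  unfold eulerOp
  rw [taylorCoeff_add (f := fun z => z * deriv f z) (by fun_prop) (by fun_prop),
    taylorCoeff_const_mul, hθ]
  ring

lemma eulerOp_eulerOp (p q : ℂ) {z : ℂ} (hf : AnalyticAt ℂ f z) :
    eulerOp p (eulerOp q f) z
      = z ^ 2 * deriv (deriv f) z + (p + q + 1) * (z * deriv f z) + p * q * f z := by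
  have h : HasDerivAt (eulerOp q f) (1 * deriv f z + z * deriv (deriv f) z + q * deriv f z) z :=
    ((hasDerivAt_id z).fun_mul hf.deriv.differentiableAt.hasDerivAt).fun_add
      (hf.differentiableAt.hasDerivAt.const_mul q)
  rw [eulerOp, h.deriv, eulerOp]
  ring

lemma hasSum_taylorCoeff {r : ℝ} (hf : DifferentiableOn ℂ f (Metric.ball 0 r)) {z : ℂ}
    (hz : z ∈ Metric.ball (0 : ℂ) r) : HasSum (fun n => taylorCoeff f n * z ^ n) (f z) := by
  convert! Complex.hasSum_taylorSeries_on_ball hf hz using 2 with n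
  rw [taylorCoeff, smul_eq_mul, smul_eq_mul, sub_zero]
  ring

lemma eventuallyEq_of_taylorCoeff_eq (hf : AnalyticAt ℂ f 0) (hg : AnalyticAt ℂ g 0)
    (h : taylorCoeff f = taylorCoeff g) : f =ᶠ[𝓝 0] g := by
  obtain ⟨r, hr, hfg⟩ := Metric.eventually_nhds_iff_ball.1
    (hf.eventually_analyticAt.and hg.eventually_analyticAt)
  filter_upwards [Metric.ball_mem_nhds _ hr] with z hz
  have hf' := hasSum_taylorCoeff
    (fun w hw => (hfg w hw).1.differentiableAt.differentiableWithinAt) hz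
  rw [h] at hf'
  exact hf'.unique (hasSum_taylorCoeff
    (fun w hw => (hfg w hw).2.differentiableAt.differentiableWithinAt) hz)

end Taylor

section Growth

variable {E : Type*} [SeminormedAddCommGroup E]

lemma exists_norm_le_geometric_of_three_term {u : ℕ → E} {p q : ℕ → ℝ} (hp : ∀ n, 0 ≤ p n)
    (hq : ∀ n, 0 ≤ q n) (h : ∀ n, ‖u (n + 2)‖ ≤ p n * ‖u (n + 1)‖ + q n * ‖u n‖)
    (hpq : Tendsto (fun n => p n + q n) atTop (𝓝 1)) {ρ : ℝ} (hρ : 1 < ρ) :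
    ∃ C, ∀ n, ‖u n‖ ≤ C * ρ ^ n := by
  obtain ⟨N, hN⟩ := eventually_atTop.1 (hpq.eventually_le_const hρ)
  set C := ∑ k ∈ Finset.range (N + 2), ‖u k‖
  have hC : 0 ≤ C := Finset.sum_nonneg fun _ _ => norm_nonneg _
  refine ⟨C, fun n => ?_⟩
  induction n using Nat.strong_induction_on with
  | _ n ih =>
    rcases lt_or_ge n (N + 2) with hn | hn
    · calc ‖u n‖ ≤ C := Finset.single_le_sum (f := fun k => ‖u k‖) (fun _ _ => norm_nonneg _)
            (Finset.mem_range.2 hn)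
        _ ≤ C * ρ ^ n := le_mul_of_one_le_right hC (one_le_pow₀ hρ.le)
    · obtain ⟨m, rfl⟩ : ∃ m, n = m + 2 := ⟨n - 2, by lia⟩
      have hm : ‖u m‖ ≤ C * ρ ^ (m + 1) :=
        (ih m (by lia)).trans (by gcongr; exacts [hρ.le, m.le_succ])
      calc ‖u (m + 2)‖ ≤ p m * ‖u (m + 1)‖ + q m * ‖u m‖ := h m
        _ ≤ p m * (C * ρ ^ (m + 1)) + q m * (C * ρ ^ (m + 1)) := by
            gcongr
            exacts [hp m, ih _ (by lia), hq m]
        _ = (p m + q m) * (C * ρ ^ (m + 1)) := by ring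
        _ ≤ ρ * (C * ρ ^ (m + 1)) := by gcongr; exact hN m (by lia)
        _ = C * ρ ^ (m + 2) := by ring

lemma one_le_radius_of_norm_le_geometric {u : ℕ → ℂ}
    (h : ∀ ρ : ℝ, 1 < ρ → ∃ C, ∀ n, ‖u n‖ ≤ C * ρ ^ n) :
    1 ≤ (FormalMultilinearSeries.ofScalars ℂ u).radius := by
  refine ENNReal.le_of_forall_nnreal_lt fun r hr => ?_
  rcases eq_or_ne r 0 with rfl | h0
  · simp
  have hr0 : 0 < (r : ℝ) := by positivity
  obtain ⟨C, hC⟩ := h (r : ℝ)⁻¹ ((one_lt_inv₀ hr0).2 (by exact_mod_cast hr))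
  refine FormalMultilinearSeries.le_radius_of_bound _ C fun n => ?_
  calc ‖FormalMultilinearSeries.ofScalars ℂ u n‖ * (r : ℝ) ^ n
      ≤ C * (r : ℝ)⁻¹ ^ n * (r : ℝ) ^ n := by
        rw [FormalMultilinearSeries.ofScalars_norm]
        gcongr
        exact hC n
    _ = C := by rw [mul_assoc, ← mul_pow, inv_mul_cancel₀ hr0.ne', one_pow, mul_one]

end Growth

section PowerSeries

variable {u : ℕ → ℂ} (h : 1 ≤ (FormalMultilinearSeries.ofScalars ℂ u).radius)

include h

lemma hasFPowerSeriesOnBall_ofScalars : HasFPowerSeriesOnBall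
    (FormalMultilinearSeries.ofScalars ℂ u).sum (FormalMultilinearSeries.ofScalars ℂ u) 0 1 :=
  ((FormalMultilinearSeries.ofScalars ℂ u).hasFPowerSeriesOnBall (one_pos.trans_le h)).mono
    one_pos h

lemma differentiableOn_sum_ofScalars :
    DifferentiableOn ℂ (FormalMultilinearSeries.ofScalars ℂ u).sum (Metric.ball (0 : ℂ) 1) := by
  have := (hasFPowerSeriesOnBall_ofScalars h).differentiableOn
  rwa [← ENNReal.ofReal_one, Metric.eball_ofReal] at this

lemma taylorCoeff_sum_ofScalars :
    taylorCoeff (FormalMultilinearSeries.ofScalars ℂ u).sum = u := by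
  funext n
  rw [taylorCoeff_eq_coeff (hasFPowerSeriesOnBall_ofScalars h).hasFPowerSeriesAt,
    FormalMultilinearSeries.coeff_ofScalars]

end PowerSeries

/-- The hypergeometric differential operator
`z (1 - z) f'' + (c - (a + b + 1) z) f' - a b f`. -/
def hyperOp (a b c : ℂ) (f : ℂ → ℂ) (z : ℂ) : ℂ :=
  z * (1 - z) * deriv (deriv f) z + (c - (a + b + 1) * z) * deriv f z - a * b * f z

section HyperOp

variable {a b c : ℂ} {f g : ℂ → ℂ}

lemma analyticAt_hyperOp (a b c : ℂ) {z : ℂ} (hf : AnalyticAt ℂ f z) :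
    AnalyticAt ℂ (hyperOp a b c f) z := by
  have := hf.deriv
  have := hf.deriv.deriv
  unfold hyperOp
  fun_prop

lemma id_mul_hyperOp (a b c : ℂ) {z : ℂ} (hf : AnalyticAt ℂ f z) :
    z * hyperOp a b c f z
      = eulerOp 0 (eulerOp (c - 1) f) z + -1 * (z * eulerOp a (eulerOp b f) z) := by
  rw [hyperOp, eulerOp_eulerOp _ _ hf, eulerOp_eulerOp _ _ hf]
  ring

lemma taylorCoeff_hyperOp (a b c : ℂ) (hf : AnalyticAt ℂ f 0) (n : ℕ) :
    taylorCoeff (hyperOp a b c f) n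
      = (n + 1) * (n + c) * taylorCoeff f (n + 1) - (n + a) * (n + b) * taylorCoeff f n := by
  have hc := analyticAt_eulerOp (c - 1) hf
  have hb := analyticAt_eulerOp b hf
  have hab := analyticAt_eulerOp a hb
  rw [← taylorCoeff_id_mul_succ (analyticAt_hyperOp a b c hf),
    taylorCoeff_congr (hf.eventually_analyticAt.mono fun z hz => id_mul_hyperOp a b c hz),
    taylorCoeff_add (analyticAt_eulerOp 0 hc) (by fun_prop), taylorCoeff_const_mul,
    taylorCoeff_id_mul_succ hab, taylorCoeff_eulerOp _ hc, taylorCoeff_eulerOp _ hf,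
    taylorCoeff_eulerOp _ hb, taylorCoeff_eulerOp _ hf]
  push_cast
  ring

lemma eventuallyEq_of_hyperOp_eq_zero (hc : ∀ n : ℕ, (n : ℂ) + c ≠ 0)
    (hf : AnalyticAt ℂ f 0) (hg : AnalyticAt ℂ g 0) (hf0 : ∀ᶠ z in 𝓝 0, hyperOp a b c f z = 0)
    (hg0 : ∀ᶠ z in 𝓝 0, hyperOp a b c g z = 0) (h : f 0 = g 0) : f =ᶠ[𝓝 0] g := by
  refine eventuallyEq_of_taylorCoeff_eq hf hg (funext fun n => ?_)
  induction n with
  | zero => rwa [taylorCoeff_zero, taylorCoeff_zero]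
  | succ n ih =>
    have hfn := taylorCoeff_hyperOp a b c hf n
    have hgn := taylorCoeff_hyperOp a b c hg n
    rw [taylorCoeff_eq_zero hf0] at hfn
    rw [taylorCoeff_eq_zero hg0, ← ih] at hgn
    refine mul_left_cancel₀ (mul_ne_zero n.cast_add_one_ne_zero (hc n)) ?_
    linear_combination hgn - hfn

end HyperOp

section Series

lemma ordinaryHypergeometricCoefficient_succ {a b c : ℂ} (hc : ∀ n : ℕ, (n : ℂ) + c ≠ 0)
    (n : ℕ) : (n + 1) * (n + c) * ordinaryHypergeometricCoefficient a b c (n + 1)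
      = (n + a) * (n + b) * ordinaryHypergeometricCoefficient a b c n := by
  have hn : (n : ℂ) + 1 ≠ 0 := n.cast_add_one_ne_zero
  have hcn : c + (n : ℂ) ≠ 0 := by rw [add_comm]; exact hc n
  have hpoch : (ascPochhammer ℂ n).eval c ≠ 0 := by
    rw [Ne, ascPochhammer_eval_eq_zero_iff]
    rintro ⟨k, -, hk⟩
    exact hc k (by rw [hk, neg_add_cancel])
  simp only [ordinaryHypergeometricCoefficient, ascPochhammer_succ_eval, Nat.factorial_succ]
  push_cast
  field_simp
  ring

lemma one_le_radius_ordinaryHypergeometricSeries (a b c : ℂ) :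
    1 ≤ (ordinaryHypergeometricSeries ℂ a b c).radius := by
  by_cases h : ∀ n : ℕ, (n : ℂ) ≠ -a ∧ (n : ℂ) ≠ -b ∧ (n : ℂ) ≠ -c
  · exact (ordinaryHypergeometricSeries_radius_eq_one ℂ a b c h).ge
  · obtain ⟨n, hn⟩ : ∃ n : ℕ, -n = a ∨ -n = b ∨ -n = c := by
      simp only [not_forall, not_and_or, not_not] at h
      exact h.imp fun n hn =>
        hn.imp neg_eq_iff_eq_neg.2 (Or.imp neg_eq_iff_eq_neg.2 neg_eq_iff_eq_neg.2)
    rcases hn with rfl | rfl | rfl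
    · exact le_top.trans (ordinaryHypergeometric_radius_top_of_neg_nat₁ ℂ b c).ge
    · exact le_top.trans (ordinaryHypergeometric_radius_top_of_neg_nat₂ ℂ a c).ge
    · exact le_top.trans (ordinaryHypergeometric_radius_top_of_neg_nat₃ ℂ a b).ge

lemma differentiableOn_ordinaryHypergeometric (a b c : ℂ) :
    DifferentiableOn ℂ (ordinaryHypergeometric a b c : ℂ → ℂ) (Metric.ball 0 1) :=
  differentiableOn_sum_ofScalars (one_le_radius_ordinaryHypergeometricSeries a b c)

lemma taylorCoeff_ordinaryHypergeometric (a b c : ℂ) :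
    taylorCoeff (ordinaryHypergeometric a b c) = ordinaryHypergeometricCoefficient a b c :=
  taylorCoeff_sum_ofScalars (one_le_radius_ordinaryHypergeometricSeries a b c)

lemma analyticAt_ordinaryHypergeometric (a b c : ℂ) :
    AnalyticAt ℂ (ordinaryHypergeometric a b c : ℂ → ℂ) 0 :=
  (differentiableOn_ordinaryHypergeometric a b c).analyticAt (Metric.ball_mem_nhds _ one_pos)

lemma hyperOp_ordinaryHypergeometric {a b c : ℂ} (hc : ∀ n : ℕ, (n : ℂ) + c ≠ 0) :
    ∀ᶠ z in 𝓝 0, hyperOp a b c (ordinaryHypergeometric a b c) z = 0 := by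
  have hf := analyticAt_ordinaryHypergeometric a b c
  refine eventuallyEq_of_taylorCoeff_eq (analyticAt_hyperOp a b c hf)
    (analyticAt_const (v := (0 : ℂ))) (funext fun n => ?_)
  rw [taylorCoeff_hyperOp a b c hf, taylorCoeff_ordinaryHypergeometric,
    ordinaryHypergeometricCoefficient_succ hc, sub_self,
    taylorCoeff_eq_zero (Eventually.of_forall fun _ => rfl)]

end Series

/-- The pullback of `g` under the conformal map `w ↦ 4 w / (1 + w) ^ 2` from the unit disc onto the
cut plane, weighted by `(1 + w) ^ s`. -/
def discPullback (s : ℂ) (g : ℂ → ℂ) (w : ℂ) : ℂ := (1 + w) ^ s * g (4 * w / (1 + w) ^ 2)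

section DiscPullback

variable {a b c s w : ℂ} {f g : ℂ → ℂ}

lemma deriv_deriv_eq {f' : ℂ → ℂ} {z f'' : ℂ} (h : ∀ᶠ w in 𝓝 z, HasDerivAt f (f' w) w)
    (h' : HasDerivAt f' f'' z) : deriv (deriv f) z = f'' := by
  have hf' : deriv f =ᶠ[𝓝 z] f' := h.mono fun w hw => hw.deriv
  rw [hf'.deriv_eq, h'.deriv]

lemma hasDerivAt_discMap (hw : 1 + w ≠ 0) :
    HasDerivAt (fun w : ℂ => 4 * w / (1 + w) ^ 2) (4 * (1 - w) / (1 + w) ^ 3) w := by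
  refine (((hasDerivAt_id w).const_mul 4).fun_div (((hasDerivAt_id w).const_add 1).fun_pow 2)
    (pow_ne_zero 2 hw)).congr_deriv ?_
  simp only [id]
  field_simp
  norm_num
  ring

lemma discPullback_eq_pow_mul (hw : 1 + w ≠ 0) (s : ℂ) (g : ℂ → ℂ) (n : ℕ) :
    discPullback s g w = (1 + w) ^ n * discPullback (s - n) g w := by
  rw [discPullback, discPullback, Complex.cpow_sub _ _ hw, Complex.cpow_natCast]
  field_simp

lemma hasDerivAt_discPullback (hw : 1 + w ∈ Complex.slitPlane)
    (hg : DifferentiableAt ℂ g (4 * w / (1 + w) ^ 2)) :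
    HasDerivAt (discPullback s g)
      (s * discPullback (s - 1) g w + 4 * (1 - w) * discPullback (s - 3) (deriv g) w) w := by
  have hw0 := Complex.slitPlane_ne_zero hw
  refine ((((hasDerivAt_id w).const_add 1).cpow_const (c := s) hw).fun_mul
    (hg.hasDerivAt.comp w (hasDerivAt_discMap hw0))).congr_deriv ?_
  simp only [id, Function.comp, discPullback]
  rw [Complex.cpow_sub s 3 hw0, Complex.cpow_ofNat]
  field_simp

lemma analyticAt_discPullback (s : ℂ) (hw : 1 + w ∈ Complex.slitPlane)
    (hg : AnalyticAt ℂ g (4 * w / (1 + w) ^ 2)) : AnalyticAt ℂ (discPullback s g) w := by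
  refine (AnalyticAt.cpow (by fun_prop) analyticAt_const hw).mul (AnalyticAt.fun_comp hg ?_)
  exact AnalyticAt.div (by fun_prop) (by fun_prop) (pow_ne_zero 2 (Complex.slitPlane_ne_zero hw))

lemma deriv_deriv_discPullback (hw : 1 + w ∈ Complex.slitPlane)
    (hg : AnalyticAt ℂ g (4 * w / (1 + w) ^ 2)) :
    deriv (deriv (discPullback s g)) w
      = s * ((s - 1) * discPullback (s - 2) g w
          + 4 * (1 - w) * discPullback (s - 4) (deriv g) w)
        + (4 * (1 - w) * ((s - 3) * discPullback (s - 4) (deriv g) w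
            + 4 * (1 - w) * discPullback (s - 6) (deriv (deriv g)) w)
          - 4 * discPullback (s - 3) (deriv g) w) := by
  have hev : ∀ᶠ u in 𝓝 w, HasDerivAt (discPullback s g)
      (s * discPullback (s - 1) g u + 4 * (1 - u) * discPullback (s - 3) (deriv g) u) u := by
    have hw1 : ContinuousAt (fun u : ℂ => 1 + u) w := by fun_prop
    filter_upwards [hw1.eventually_mem (Complex.isOpen_slitPlane.mem_nhds hw),
      (hasDerivAt_discMap (Complex.slitPlane_ne_zero hw)).continuousAt.eventually
        hg.eventually_analyticAt] with u hu hgu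
    exact hasDerivAt_discPullback hu hgu.differentiableAt
  refine deriv_deriv_eq hev ((((hasDerivAt_discPullback (s := s - 1) hw
    hg.differentiableAt).const_mul s).fun_add ((((hasDerivAt_id w).const_sub 1).const_mul 4).fun_mul
      (hasDerivAt_discPullback (s := s - 3) hw hg.deriv.differentiableAt))).congr_deriv ?_)
  simp only [id]
  ring_nf

lemma eulerOp_discPullback (a b c : ℂ) (hw : 1 + w ∈ Complex.slitPlane)
    (hf : AnalyticAt ℂ f (4 * w / (1 + w) ^ 2)) :
    eulerOp 0 (eulerOp (c - 1) (discPullback (-(2 * a)) f)) w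
        + (2 * (c - 2 * b) * (w * eulerOp a (discPullback (-(2 * a)) f) w)
        + -1 * (w * (w * eulerOp (2 * a) (eulerOp (2 * a - c + 1) (discPullback (-(2 * a)) f)) w)))
      = 4 * w * (1 - w) * discPullback (-(2 * a) - 1) (hyperOp a b c f) w := by
  have hw0 := Complex.slitPlane_ne_zero hw
  have hv := analyticAt_discPullback (-(2 * a)) hw hf
  rw [eulerOp_eulerOp _ _ hv, eulerOp_eulerOp _ _ hv, eulerOp, deriv_deriv_discPullback hw hf,
    (hasDerivAt_discPullback hw hf.differentiableAt).deriv]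
  rw [discPullback_eq_pow_mul hw0 (-(2 * a)) f 6, discPullback_eq_pow_mul hw0 (-(2 * a) - 1) f 5,
    discPullback_eq_pow_mul hw0 (-(2 * a) - 2) f 4,
    discPullback_eq_pow_mul hw0 (-(2 * a) - 3) (deriv f) 3,
    discPullback_eq_pow_mul hw0 (-(2 * a) - 4) (deriv f) 2,
    discPullback_eq_pow_mul hw0 (-(2 * a) - 1) (hyperOp a b c f) 5]
  push_cast
  rw [show -(2 * a) - 1 - 5 = -(2 * a) - 6 by ring, show -(2 * a) - 2 - 4 = -(2 * a) - 6 by ring,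
    show -(2 * a) - 3 - 3 = -(2 * a) - 6 by ring, show -(2 * a) - 4 - 2 = -(2 * a) - 6 by ring]
  simp only [discPullback, hyperOp]
  field_simp
  ring

lemma eventually_discPullback_equation (hf : AnalyticAt ℂ f 0)
    (h : ∀ᶠ z in 𝓝 0, hyperOp a b c f z = 0) :
    ∀ᶠ w in 𝓝 0, eulerOp 0 (eulerOp (c - 1) (discPullback (-(2 * a)) f)) w
      + (2 * (c - 2 * b) * (w * eulerOp a (discPullback (-(2 * a)) f) w)
      + -1 * (w * (w * eulerOp (2 * a) (eulerOp (2 * a - c + 1) (discPullback (-(2 * a)) f)) w)))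
        = 0 := by
  have hslit : ContinuousAt (fun w : ℂ => 1 + w) 0 := by fun_prop
  have hmap : Tendsto (fun w : ℂ => 4 * w / (1 + w) ^ 2) (𝓝 0) (𝓝 0) := by
    simpa [ContinuousAt] using (hasDerivAt_discMap (w := 0) (by simp)).continuousAt
  filter_upwards [hslit.eventually_mem (Complex.isOpen_slitPlane.mem_nhds (by simp)),
    hmap.eventually hf.eventually_analyticAt, hmap.eventually h] with w hw hfw hop
  rw [eulerOp_discPullback a b c hw hfw, discPullback, hop, mul_zero, mul_zero]

lemma taylorCoeff_discPullback (hf : AnalyticAt ℂ f 0)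
    (h : ∀ᶠ z in 𝓝 0, hyperOp a b c f z = 0) (n : ℕ) :
    (n + 2) * (n + (1 + c)) * taylorCoeff (discPullback (-(2 * a)) f) (n + 2)
      = -2 * (c - 2 * b) * (n + (1 + a)) * taylorCoeff (discPullback (-(2 * a)) f) (n + 1)
        + (n + 2 * a) * (n + (2 * a - c + 1)) * taylorCoeff (discPullback (-(2 * a)) f) n := by
  have heq := taylorCoeff_eq_zero (eventually_discPullback_equation hf h) (n + 2)
  have hv : AnalyticAt ℂ (discPullback (-(2 * a)) f) 0 :=
    analyticAt_discPullback _ (by simp) (by simpa using hf)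
  have h₁ := analyticAt_eulerOp (c - 1) hv
  have h₁' := analyticAt_eulerOp 0 h₁
  have h₂ := analyticAt_eulerOp a hv
  have h₃ := analyticAt_eulerOp (2 * a - c + 1) hv
  have h₃' := analyticAt_eulerOp (2 * a) h₃
  rw [taylorCoeff_add h₁' (by fun_prop), taylorCoeff_add (by fun_prop) (by fun_prop),
    taylorCoeff_const_mul, taylorCoeff_const_mul, taylorCoeff_id_mul_succ h₂,
    taylorCoeff_id_mul_succ (f := fun w => w * _) (by fun_prop), taylorCoeff_id_mul_succ h₃',
    taylorCoeff_eulerOp _ h₁, taylorCoeff_eulerOp _ hv, taylorCoeff_eulerOp _ hv,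
    taylorCoeff_eulerOp _ h₃, taylorCoeff_eulerOp _ hv] at heq
  push_cast at heq
  linear_combination heq

lemma tendsto_natCast_add_div_add (p q : ℂ) :
    Tendsto (fun n : ℕ => ((n : ℂ) + p) / (n + q)) atTop (𝓝 1) := by
  simpa [add_comm] using tendsto_add_mul_div_add_mul_atTop_nhds p q (1 : ℂ) one_ne_zero

lemma exists_norm_taylorCoeff_discPullback_le (hc : ∀ n : ℕ, (n : ℂ) + c ≠ 0)
    (hf : AnalyticAt ℂ f 0) (h : ∀ᶠ z in 𝓝 0, hyperOp a b c f z = 0) {ρ : ℝ} (hρ : 1 < ρ) :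
    ∃ C, ∀ n, ‖taylorCoeff (discPullback (-(2 * a)) f) n‖ ≤ C * ρ ^ n := by
  refine exists_norm_le_geometric_of_three_term
    (p := fun n => ‖-2 * (c - 2 * b) * ((n + (1 + a)) / (n + (1 + c)) * ((n : ℂ) + 2)⁻¹)‖)
    (q := fun n => ‖(n + 2 * a) / (n + 2) * ((n + (2 * a - c + 1)) / (n + (1 + c)))‖)
    (fun _ => norm_nonneg _) (fun _ => norm_nonneg _) (fun n => ?_) ?_ hρ
  · have hn : (n : ℂ) + 2 ≠ 0 := by exact_mod_cast (n + 1).succ_ne_zero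
    have hcn : (n : ℂ) + (1 + c) ≠ 0 := by simpa [add_assoc] using hc (n + 1)
    rw [← norm_mul, ← norm_mul]
    refine (congrArg norm ?_).trans_le (norm_add_le _ _)
    field_simp
    linear_combination taylorCoeff_discPullback hf h n
  · have hinv : Tendsto (fun n : ℕ => ((n : ℂ) + 2)⁻¹) atTop (𝓝 0) :=
      tendsto_inv₀_cobounded.comp
        ((tendsto_add_const_cobounded 2).comp tendsto_natCast_atTop_cobounded)
    have hp := (((tendsto_natCast_add_div_add (1 + a) (1 + c)).mul hinv).const_mul
      (-2 * (c - 2 * b))).norm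
    have hq := ((tendsto_natCast_add_div_add (2 * a) 2).mul
      (tendsto_natCast_add_div_add (2 * a - c + 1) (1 + c))).norm
    simpa using hp.add hq

lemma exists_differentiableOn_eq_discPullback (hc : ∀ n : ℕ, (n : ℂ) + c ≠ 0)
    (hf : AnalyticAt ℂ f 0) (h : ∀ᶠ z in 𝓝 0, hyperOp a b c f z = 0) :
    ∃ V, DifferentiableOn ℂ V (Metric.ball 0 1) ∧ V =ᶠ[𝓝 0] discPullback (-(2 * a)) f := by
  have hrad := one_le_radius_of_norm_le_geometric
    fun ρ hρ => exists_norm_taylorCoeff_discPullback_le (ρ := ρ) hc hf h hρ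
  have hV := differentiableOn_sum_ofScalars hrad
  exact ⟨_, hV, eventuallyEq_of_taylorCoeff_eq
    (hV.analyticAt (Metric.ball_mem_nhds _ one_pos))
    (analyticAt_discPullback _ (by simp) (by simpa using hf)) (taylorCoeff_sum_ofScalars hrad)⟩

end DiscPullback

section CutPlane

lemma mem_cutPlane_iff {z : ℂ} : z ∈ cutPlane ↔ 1 - z ∈ Complex.slitPlane := by
  simp only [cutPlane, Set.mem_ofPred_eq, Complex.mem_slitPlane_iff, Complex.sub_re, Complex.one_re,
    Complex.sub_im, Complex.one_im, sub_pos, zero_sub, neg_ne_zero, not_and_or, not_le, or_comm,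
    ne_eq]

lemma cutPlane_eq_preimage : cutPlane = (fun z => 1 - z) ⁻¹' Complex.slitPlane :=
  Set.ext fun _ => mem_cutPlane_iff

lemma isOpen_cutPlane : IsOpen cutPlane := by
  rw [cutPlane_eq_preimage]
  exact Complex.isOpen_slitPlane.preimage (by fun_prop)

lemma isPreconnected_cutPlane : IsPreconnected cutPlane := by
  rw [cutPlane_eq_preimage,
    ← Set.image_eq_preimage_of_inverse (sub_sub_cancel 1) (sub_sub_cancel 1)]
  exact ((Complex.starConvex_one_slitPlane.isPathConnected
    (by simp)).isConnected.isPreconnected).image _ (by fun_prop)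

lemma ball_subset_cutPlane : Metric.ball (0 : ℂ) 1 ⊆ cutPlane := fun z hz h =>
  absurd ((Complex.re_le_norm z).trans_lt (mem_ball_zero_iff.1 hz)) h.2.not_gt

lemma zero_mem_cutPlane : (0 : ℂ) ∈ cutPlane := ball_subset_cutPlane (by simp)

end CutPlane

/-- The inverse of the conformal map `w ↦ 4 w / (1 + w) ^ 2` from the unit disc onto the cut
plane. -/
def discCoord (z : ℂ) : ℂ := (1 - Complex.sqrt (1 - z)) / (1 + Complex.sqrt (1 - z))

section DiscCoord

variable {z : ℂ}

lemma re_sqrt_pos (hz : z ∈ Complex.slitPlane) : 0 < (Complex.sqrt z).re := by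
  rw [Complex.sqrt, Complex.cpow_inv_two_re, Real.sqrt_pos]
  rcases Complex.mem_slitPlane_iff.1 hz with h | h
  · positivity
  · linarith [neg_abs_le z.re, Complex.abs_re_lt_norm.2 h]

lemma sqrt_sq (z : ℂ) : Complex.sqrt z ^ 2 = z := Complex.cpow_ofNat_inv_pow z 2

lemma one_add_sqrt_ne_zero (hz : z ∈ Complex.slitPlane) : 1 + Complex.sqrt z ≠ 0 :=
  Complex.slitPlane_ne_zero (Or.inl (by
    rw [Complex.add_re, Complex.one_re]
    linarith [re_sqrt_pos hz]))

lemma norm_discCoord_lt (hz : z ∈ cutPlane) : ‖discCoord z‖ < 1 := by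
  have hz' := mem_cutPlane_iff.1 hz
  rw [discCoord, norm_div, div_lt_one (norm_pos_iff.2 (one_add_sqrt_ne_zero hz')),
    ← sq_lt_sq₀ (norm_nonneg _) (norm_nonneg _), Complex.sq_norm, Complex.sq_norm,
    Complex.normSq_apply, Complex.normSq_apply]
  simp only [Complex.sub_re, Complex.add_re, Complex.sub_im, Complex.add_im, Complex.one_re,
    Complex.one_im]
  linarith [re_sqrt_pos hz']

lemma differentiableOn_discCoord : DifferentiableOn ℂ discCoord cutPlane := fun z hz => by
  have hz' := mem_cutPlane_iff.1 hz
  have hsqrt : DifferentiableAt ℂ (fun z => Complex.sqrt (1 - z)) z :=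
    DifferentiableAt.comp z (Complex.differentiableAt_sqrt hz') (by fun_prop)
  exact ((hsqrt.const_sub 1).div (hsqrt.const_add 1)
    (one_add_sqrt_ne_zero hz')).differentiableWithinAt

lemma discMap_discCoord (hz : z ∈ cutPlane) :
    4 * discCoord z / (1 + discCoord z) ^ 2 = z := by
  have hne := one_add_sqrt_ne_zero (mem_cutPlane_iff.1 hz)
  have hadd : 1 + discCoord z = 2 / (1 + Complex.sqrt (1 - z)) := by
    rw [discCoord]
    field_simp
    ring
  rw [hadd, discCoord]
  field_simp
  linear_combination -4 * sqrt_sq (1 - z)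

end DiscCoord

lemma discPullback_discCoord {z : ℂ} (hz : z ∈ cutPlane) (s : ℂ) (g : ℂ → ℂ) :
    (1 + discCoord z) ^ s * discPullback (-s) g (discCoord z) = g z := by
  have hne : 1 + discCoord z ≠ 0 :=
    Complex.slitPlane_ne_zero (Complex.mem_slitPlane_of_norm_lt_one (norm_discCoord_lt hz))
  rw [discPullback, discMap_discCoord hz, ← mul_assoc, ← Complex.cpow_add _ _ hne, add_neg_cancel,
    Complex.cpow_zero, one_mul]

/-- The series of `₂F₁` in the coordinate `discCoord` converges on the whole disc, which gives the
continuation. -/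
lemma exists_continuation_ordinaryHypergeometric (a b : ℂ) {c : ℂ}
    (hc : ∀ n : ℕ, (n : ℂ) + c ≠ 0) :
    ∃ F, DifferentiableOn ℂ F cutPlane ∧
      Set.EqOn F (ordinaryHypergeometric a b c) (Metric.ball 0 1) := by
  obtain ⟨V, hV, hVf⟩ := exists_differentiableOn_eq_discPullback hc
    (analyticAt_ordinaryHypergeometric a b c) (hyperOp_ordinaryHypergeometric hc)
  have hF : DifferentiableOn ℂ (fun z => (1 + discCoord z) ^ (2 * a) * V (discCoord z))
      cutPlane :=
    ((differentiableOn_discCoord.const_add 1).cpow_const fun z hz =>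
      Complex.mem_slitPlane_of_norm_lt_one (norm_discCoord_lt hz)).mul
    (hV.comp differentiableOn_discCoord fun z hz =>
      mem_ball_zero_iff.2 (norm_discCoord_lt hz))
  have hcut := isOpen_cutPlane.mem_nhds zero_mem_cutPlane
  have hlim : Tendsto discCoord (𝓝 0) (𝓝 0) := by
    have h0 : discCoord 0 = 0 := by simp [discCoord]
    simpa only [ContinuousAt, h0] using
      (differentiableOn_discCoord.differentiableAt hcut).continuousAt
  refine ⟨_, hF, AnalyticOnNhd.eqOn_of_preconnected_of_eventuallyEq
    ((hF.mono ball_subset_cutPlane).analyticOnNhd Metric.isOpen_ball)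
    ((differentiableOn_ordinaryHypergeometric a b c).analyticOnNhd Metric.isOpen_ball)
    (convex_ball _ _).isPreconnected (Metric.mem_ball_self one_pos) ?_⟩
  filter_upwards [hlim.eventually hVf, hcut] with z hz hzc
  rw [hz, discPullback_discCoord hzc]

section Parameters

variable {c : ℝ}

lemma natCast_add_ofReal_ne_zero (hc : ∀ n : ℤ, c ≠ n) (n : ℕ) : (n : ℂ) + (c : ℂ) ≠ 0 := by
  intro h
  have hn : (n : ℝ) + c = 0 := by exact_mod_cast h
  exact hc (-n) (by push_cast; exact eq_neg_of_add_eq_zero_right hn)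

lemma isContinuation_gauss2F1 (a b : ℝ) (hc : ∀ n : ℤ, c ≠ n) :
    IsContinuation a b c (gauss2F1 a b c) := by
  have h : ∃ F, IsContinuation a b c F := by
    obtain ⟨F, hF, hball⟩ :=
      exists_continuation_ordinaryHypergeometric a b (natCast_add_ofReal_ne_zero hc)
    exact ⟨F, hF, fun z hz => hball (mem_ball_zero_iff.2 hz)⟩
  have heq : gauss2F1 a b c = h.choose := funext fun z => by rw [gauss2F1, dif_pos h]
  rw [heq]
  exact h.choose_spec

end Parameters

/-- `f` is a holomorphic solution of the hypergeometric equation on `Ω`. -/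
structure IsHyperSol (a b c : ℂ) (f : ℂ → ℂ) (Ω : Set ℂ) : Prop where
  differentiableOn : DifferentiableOn ℂ f Ω
  hyperOp_eq_zero : ∀ z ∈ Ω, hyperOp a b c f z = 0

/-- `φ` is a branch of a nonzero multiple of `z ^ p` on `Ω`, characterised by `z φ' = p φ`. -/
structure IsPowBranch (p : ℂ) (φ : ℂ → ℂ) (Ω : Set ℂ) : Prop where
  zero_notMem : (0 : ℂ) ∉ Ω
  ne_zero : ∀ z ∈ Ω, φ z ≠ 0
  hasDerivAt : ∀ z ∈ Ω, HasDerivAt φ (p * φ z / z) z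

section IsHyperSol

variable {a b c : ℂ} {f g φ : ℂ → ℂ} {Ω Ω' : Set ℂ} {z : ℂ}

lemma IsHyperSol.mono (h : IsHyperSol a b c f Ω) (hs : Ω' ⊆ Ω) : IsHyperSol a b c f Ω' :=
  ⟨h.differentiableOn.mono hs, fun z hz => h.hyperOp_eq_zero z (hs hz)⟩

lemma IsHyperSol.analyticAt (h : IsHyperSol a b c f Ω) (hΩ : IsOpen Ω) (hz : z ∈ Ω) :
    AnalyticAt ℂ f z :=
  h.differentiableOn.analyticAt (hΩ.mem_nhds hz)

lemma IsPowBranch.mono {p : ℂ} (h : IsPowBranch p φ Ω) (hs : Ω' ⊆ Ω) : IsPowBranch p φ Ω' :=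
  ⟨fun h0 => h.zero_notMem (hs h0), fun z hz => h.ne_zero z (hs hz),
    fun z hz => h.hasDerivAt z (hs hz)⟩

lemma hyperOp_mul_powBranch (hΩ : IsOpen Ω) (hφ : IsPowBranch (1 - c) φ Ω) (hz : z ∈ Ω)
    (hg : AnalyticAt ℂ g z) :
    hyperOp a b c (fun w => φ w * g w) z
      = φ z * hyperOp (1 + a - c) (1 + b - c) (2 - c) g z := by
  have hz0 : z ≠ 0 := fun h => hφ.zero_notMem (h ▸ hz)
  have hderiv : ∀ᶠ w in 𝓝 z, HasDerivAt (fun w => φ w * g w)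
      ((1 - c) * φ w / w * g w + φ w * deriv g w) w := by
    filter_upwards [hΩ.mem_nhds hz, hg.eventually_analyticAt] with w hw hgw
    exact (hφ.hasDerivAt w hw).fun_mul hgw.differentiableAt.hasDerivAt
  have hderiv2 := ((((hφ.hasDerivAt z hz).const_mul (1 - c)).fun_div (hasDerivAt_id' z)
    hz0).fun_mul hg.differentiableAt.hasDerivAt).fun_add
    ((hφ.hasDerivAt z hz).fun_mul hg.deriv.differentiableAt.hasDerivAt)
  rw [hyperOp, hyperOp, deriv_deriv_eq hderiv hderiv2, hderiv.self_of_nhds.deriv]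
  field_simp
  ring

lemma IsHyperSol.powBranch_mul (hΩ : IsOpen Ω)
    (hg : IsHyperSol (1 + a - c) (1 + b - c) (2 - c) g Ω) (hφ : IsPowBranch (1 - c) φ Ω) :
    IsHyperSol a b c (fun z => φ z * g z) Ω where
  differentiableOn z hz := ((hφ.hasDerivAt z hz).differentiableAt.mul
    (hg.analyticAt hΩ hz).differentiableAt).differentiableWithinAt
  hyperOp_eq_zero z hz := by
    rw [hyperOp_mul_powBranch hΩ hφ hz (hg.analyticAt hΩ hz), hg.hyperOp_eq_zero z hz, mul_zero]

lemma hyperOp_reflect (a b c : ℂ) (f : ℂ → ℂ) (z : ℂ) :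
    hyperOp a b c (fun w => f (1 - w)) z = hyperOp a b (a + b - c + 1) f (1 - z) := by
  have hderiv : deriv (fun w => f (1 - w)) = fun w => -deriv f (1 - w) :=
    funext fun w => deriv_comp_const_sub f 1 w
  rw [hyperOp, hyperOp, hderiv, deriv.fun_neg, deriv_comp_const_sub, neg_neg]
  ring

lemma IsHyperSol.reflect (h : IsHyperSol a b (a + b - c + 1) f Ω) (hs : ∀ z ∈ Ω', 1 - z ∈ Ω) :
    IsHyperSol a b c (fun z => f (1 - z)) Ω' where
  differentiableOn := h.differentiableOn.comp (by fun_prop) hs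
  hyperOp_eq_zero z hz := by rw [hyperOp_reflect, h.hyperOp_eq_zero _ (hs z hz)]

end IsHyperSol

lemma hasDerivAt_cpow_const_div (p : ℂ) {z : ℂ} (hz : z ∈ Complex.slitPlane) :
    HasDerivAt (fun w : ℂ => w ^ p) (p * z ^ p / z) z := by
  refine ((hasDerivAt_id' z).cpow_const (c := p) hz).congr_deriv ?_
  rw [Complex.cpow_sub _ _ (Complex.slitPlane_ne_zero hz), Complex.cpow_one, mul_one, mul_div_assoc]

lemma isPowBranch_cpow (p : ℂ) : IsPowBranch p (fun z => z ^ p) Complex.slitPlane where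
  zero_notMem := Complex.zero_notMem_slitPlane
  ne_zero z hz := by simp [Complex.cpow_eq_zero_iff, Complex.slitPlane_ne_zero hz]
  hasDerivAt _ hz := hasDerivAt_cpow_const_div p hz

section Gauss2F1

variable {c : ℝ}

lemma eventuallyEq_gauss2F1 (a b : ℝ) (hc : ∀ n : ℤ, c ≠ n) :
    gauss2F1 a b c =ᶠ[𝓝 0] ordinaryHypergeometric (a : ℂ) (b : ℂ) (c : ℂ) :=
  eventually_of_mem (Metric.ball_mem_nhds _ one_pos) fun z hz =>
    (isContinuation_gauss2F1 a b hc).2 z (mem_ball_zero_iff.1 hz)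

lemma gauss2F1_zero (a b : ℝ) (hc : ∀ n : ℤ, c ≠ n) : gauss2F1 a b c 0 = 1 := by
  rw [(eventuallyEq_gauss2F1 a b hc).self_of_nhds, ordinaryHypergeometric_zero]

lemma taylorCoeff_gauss2F1 (a b : ℝ) (hc : ∀ n : ℤ, c ≠ n) :
    taylorCoeff (gauss2F1 a b c) = ordinaryHypergeometricCoefficient (a : ℂ) (b : ℂ) (c : ℂ) := by
  rw [taylorCoeff_congr (eventuallyEq_gauss2F1 a b hc), taylorCoeff_ordinaryHypergeometric]

lemma isHyperSol_gauss2F1 (a b : ℝ) (hc : ∀ n : ℤ, c ≠ n) :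
    IsHyperSol a b c (gauss2F1 a b c) cutPlane := by
  have hdiff := (isContinuation_gauss2F1 a b hc).1
  refine ⟨hdiff, AnalyticOnNhd.eqOn_zero_of_preconnected_of_eventuallyEq_zero (fun z hz =>
    analyticAt_hyperOp _ _ _ (hdiff.analyticAt (isOpen_cutPlane.mem_nhds hz)))
    isPreconnected_cutPlane zero_mem_cutPlane ?_⟩
  have heq := eventuallyEq_gauss2F1 a b hc
  filter_upwards [heq, heq.deriv, heq.deriv.deriv,
    hyperOp_ordinaryHypergeometric (natCast_add_ofReal_ne_zero hc)] with z e₀ e₁ e₂ hz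
  rwa [hyperOp, ← e₀, ← e₁, ← e₂] at hz

lemma eqOn_gauss2F1 {a b : ℝ} (hc : ∀ n : ℤ, c ≠ n) {f : ℂ → ℂ}
    (hf : IsHyperSol a b c f cutPlane) (hf0 : f 0 = 1) :
    Set.EqOn f (gauss2F1 a b c) cutPlane := by
  have hg := isHyperSol_gauss2F1 a b hc
  have h0 := isOpen_cutPlane.mem_nhds zero_mem_cutPlane
  refine AnalyticOnNhd.eqOn_of_preconnected_of_eventuallyEq
    (fun z hz => hf.analyticAt isOpen_cutPlane hz) (fun z hz => hg.analyticAt isOpen_cutPlane hz)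
    isPreconnected_cutPlane zero_mem_cutPlane ?_
  exact eventuallyEq_of_hyperOp_eq_zero (natCast_add_ofReal_ne_zero hc)
    (hf.analyticAt isOpen_cutPlane zero_mem_cutPlane)
    (hg.analyticAt isOpen_cutPlane zero_mem_cutPlane)
    (eventually_of_mem h0 hf.hyperOp_eq_zero) (eventually_of_mem h0 hg.hyperOp_eq_zero)
    (by rw [hf0, gauss2F1_zero a b hc])

lemma gauss2F1_symm (a b c : ℝ) : gauss2F1 a b c = gauss2F1 b a c := by
  have hseries : (ordinaryHypergeometric (a : ℂ) (b : ℂ) (c : ℂ) : ℂ → ℂ)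
      = ordinaryHypergeometric (b : ℂ) (a : ℂ) (c : ℂ) := by
    unfold ordinaryHypergeometric
    rw [ordinaryHypergeometricSeries_symm]
  unfold gauss2F1 IsContinuation
  rw [hseries]

/-- Euler's transformation: reflecting `z ↦ 1 - z` turns the exponent `c - a - b` at `1` into an
exponent at `0`, where multiplication by a branch of the power preserves the equation. -/
lemma gauss2F1_euler (a b : ℝ) (hc : ∀ n : ℤ, c ≠ n) {z : ℂ} (hz : z ∈ cutPlane) :
    gauss2F1 a b c z = (1 - z) ^ ((c : ℂ) - a - b) * gauss2F1 (c - a) (c - b) c z := by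
  have hF := isHyperSol_gauss2F1 (c - a) (c - b) hc
  push_cast at hF
  have hrefl : IsHyperSol (c - a) (c - b) (c - a - b + 1)
      (fun z => gauss2F1 (c - a) (c - b) c (1 - z)) Complex.slitPlane := by
    refine IsHyperSol.reflect (Ω := cutPlane) ?_ fun z hz => mem_cutPlane_iff.2 (by simpa using hz)
    convert hF using 1
    ring
  have hmul : IsHyperSol b a (b + a - c + 1)
      (fun z => z ^ ((c : ℂ) - a - b) * gauss2F1 (c - a) (c - b) c (1 - z)) Complex.slitPlane := by
    refine IsHyperSol.powBranch_mul Complex.isOpen_slitPlane ?_ ?_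
    · convert hrefl using 1 <;> ring
    · convert isPowBranch_cpow ((c : ℂ) - a - b) using 1
      ring
  have hsol := hmul.reflect fun z hz => mem_cutPlane_iff.1 hz
  simp only [sub_sub_cancel] at hsol
  rw [gauss2F1_symm a b]
  exact (eqOn_gauss2F1 hc hsol (by simp [gauss2F1_zero _ _ hc]) hz).symm

end Gauss2F1

/-- The Wronskian `f g' - f' g` of two functions. -/
def wronskian (f g : ℂ → ℂ) (z : ℂ) : ℂ := f z * deriv g z - deriv f z * g z

section Wronskian

variable {a b c : ℂ} {f g f₁ f₂ : ℂ → ℂ} {Ω : Set ℂ} {z : ℂ}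

lemma hasDerivAt_wronskian (hf : AnalyticAt ℂ f z) (hg : AnalyticAt ℂ g z) :
    HasDerivAt (wronskian f g) (f z * deriv (deriv g) z - deriv (deriv f) z * g z) z :=
  ((hf.differentiableAt.hasDerivAt.fun_mul hg.deriv.differentiableAt.hasDerivAt).fun_sub
    (hf.deriv.differentiableAt.hasDerivAt.fun_mul hg.differentiableAt.hasDerivAt)).congr_deriv
    (by ring)

lemma mul_deriv_wronskian (hf : AnalyticAt ℂ f z) (hg : AnalyticAt ℂ g z)
    (hf0 : hyperOp a b c f z = 0) (hg0 : hyperOp a b c g z = 0) :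
    z * (1 - z) * deriv (wronskian f g) z = -(c - (a + b + 1) * z) * wronskian f g z := by
  rw [hyperOp] at hf0 hg0
  rw [(hasDerivAt_wronskian hf hg).deriv, wronskian]
  linear_combination f z * hg0 - g z * hf0

lemma wronskian_reflect (f g : ℂ → ℂ) (z : ℂ) :
    wronskian (fun w => f (1 - w)) (fun w => g (1 - w)) z = -wronskian f g (1 - z) := by
  rw [wronskian, wronskian, deriv_comp_const_sub, deriv_comp_const_sub]
  ring

lemma exists_wronskian_eq_const_mul (hΩ : IsOpen Ω) (hΩc : IsPreconnected Ω)
    (hΩp : Ω ⊆ puncturedPlane) (h₁ : IsHyperSol a b c f₁ Ω) (h₂ : IsHyperSol a b c f₂ Ω)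
    (hw : ∀ z ∈ Ω, wronskian f₁ f₂ z ≠ 0) (hf : IsHyperSol a b c f Ω)
    (hg : IsHyperSol a b c g Ω) :
    ∃ k, ∀ z ∈ Ω, wronskian f g z = k * wronskian f₁ f₂ z := by
  have hderiv : ∀ z ∈ Ω, HasDerivAt (fun z => wronskian f g z / wronskian f₁ f₂ z) 0 z := by
    intro z hz
    have hfg := hasDerivAt_wronskian (hf.analyticAt hΩ hz) (hg.analyticAt hΩ hz)
    have h₁₂ := hasDerivAt_wronskian (h₁.analyticAt hΩ hz) (h₂.analyticAt hΩ hz)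
    refine (hfg.differentiableAt.hasDerivAt.fun_div h₁₂.differentiableAt.hasDerivAt
      (hw z hz)).congr_deriv ?_
    have e := mul_deriv_wronskian (hf.analyticAt hΩ hz) (hg.analyticAt hΩ hz)
      (hf.hyperOp_eq_zero z hz) (hg.hyperOp_eq_zero z hz)
    have e₁₂ := mul_deriv_wronskian (h₁.analyticAt hΩ hz) (h₂.analyticAt hΩ hz)
      (h₁.hyperOp_eq_zero z hz) (h₂.hyperOp_eq_zero z hz)
    have hz0 : z ≠ 0 := fun h => hΩp hz (Or.inl h)
    have hz1 : 1 - z ≠ 0 := fun h => hΩp hz (Or.inr (sub_eq_zero.1 h).symm)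
    refine div_eq_zero_iff.2 (Or.inl (mul_left_cancel₀ (mul_ne_zero hz0 hz1) ?_))
    linear_combination wronskian f₁ f₂ z * e - wronskian f g z * e₁₂
  obtain ⟨k, hk⟩ := hΩ.exists_is_const_of_deriv_eq_zero hΩc
    (fun z hz => (hderiv z hz).differentiableAt.differentiableWithinAt)
    fun z hz => (hderiv z hz).deriv
  exact ⟨k, fun z hz => (div_eq_iff (hw z hz)).1 (hk z hz)⟩

lemma IsHyperSol.exists_eq (hΩ : IsOpen Ω) (hΩc : IsPreconnected Ω)
    (hΩp : Ω ⊆ puncturedPlane) (h₁ : IsHyperSol a b c f₁ Ω) (h₂ : IsHyperSol a b c f₂ Ω)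
    (hw : ∀ z ∈ Ω, wronskian f₁ f₂ z ≠ 0) (h : IsHyperSol a b c f Ω) :
    ∃ k₁ k₂ : ℂ, ∀ z ∈ Ω, f z = k₁ * f₁ z + k₂ * f₂ z := by
  obtain ⟨k₁, hk₁⟩ := exists_wronskian_eq_const_mul hΩ hΩc hΩp h₁ h₂ hw h h₂
  obtain ⟨k₂, hk₂⟩ := exists_wronskian_eq_const_mul hΩ hΩc hΩp h₁ h₂ hw h₁ h
  refine ⟨k₁, k₂, fun z hz => mul_right_cancel₀ (hw z hz) ?_⟩
  -- Cramer's rule: `f W(f₁, f₂) = W(f, f₂) f₁ + W(f₁, f) f₂`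
  have cramer : f z * wronskian f₁ f₂ z
      = wronskian f f₂ z * f₁ z + wronskian f₁ f z * f₂ z := by
    simp only [wronskian]
    ring
  rw [cramer, hk₁ z hz, hk₂ z hz]
  ring

lemma eq_zero_of_wronskian_ne_zero {k₁ k₂ : ℂ} (h₁ : AnalyticAt ℂ f₁ z) (h₂ : AnalyticAt ℂ f₂ z)
    (hw : wronskian f₁ f₂ z ≠ 0) (h : ∀ᶠ w in 𝓝 z, k₁ * f₁ w + k₂ * f₂ w = 0) :
    k₁ = 0 ∧ k₂ = 0 := by
  have e₀ := h.self_of_nhds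
  have e₁ : k₁ * deriv f₁ z + k₂ * deriv f₂ z = 0 :=
    (((h₁.differentiableAt.hasDerivAt.const_mul k₁).fun_add
      (h₂.differentiableAt.hasDerivAt.const_mul k₂)).congr_of_eventuallyEq
      (h.mono fun _ => Eq.symm)).unique (hasDerivAt_const z 0)
  rw [wronskian] at hw
  constructor <;> refine (mul_eq_zero.1 ?_).resolve_right hw
  · linear_combination deriv f₂ z * e₀ - f₂ z * e₁
  · linear_combination f₁ z * e₁ - deriv f₁ z * e₀

/-- The Wronskian of `f` and `z ^ (1 - c) g` is `z ^ (-c)` times the expression in parentheses,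
which, unlike `z ^ (-c)`, extends over `0`. -/
lemma reducedWronskian_eq (hf : IsHyperSol a b c f cutPlane)
    (hg : IsHyperSol (1 + a - c) (1 + b - c) (2 - c) g cutPlane) (hz : z ∈ cutPlane) :
    (f z * eulerOp (1 - c) g z - z * deriv f z * g z) * (1 - z) ^ (a + b + 1 - c)
      = (1 - c) * (f 0 * g 0) := by
  set W : ℂ → ℂ := fun z =>
    (f z * eulerOp (1 - c) g z - z * deriv f z * g z) * (1 - z) ^ (a + b + 1 - c)
  have hderiv : ∀ z ∈ cutPlane, HasDerivAt W 0 z := by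
    intro z hz
    have haf := hf.analyticAt isOpen_cutPlane hz
    have hag := hg.analyticAt isOpen_cutPlane hz
    have f₀ := haf.differentiableAt.hasDerivAt
    have f₁ := haf.deriv.differentiableAt.hasDerivAt
    have g₀ := hag.differentiableAt.hasDerivAt
    have g₁ := hag.deriv.differentiableAt.hasDerivAt
    have hslit := mem_cutPlane_iff.1 hz
    have hz1 := Complex.slitPlane_ne_zero hslit
    have hW := ((f₀.fun_mul (((hasDerivAt_id' z).fun_mul g₁).fun_add
      (g₀.const_mul (1 - c)))).fun_sub (((hasDerivAt_id' z).fun_mul f₁).fun_mul g₀)).fun_mul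
      ((hasDerivAt_cpow_const_div (a + b + 1 - c) hslit).comp_const_sub 1 z)
    refine hW.congr_deriv ?_
    have ef := hf.hyperOp_eq_zero z hz
    have eg := hg.hyperOp_eq_zero z hz
    rw [hyperOp] at ef eg
    field_simp
    linear_combination (1 - z) ^ (a + b + 1 - c) * (f z * eg - g z * ef)
  obtain ⟨k, hk⟩ := isOpen_cutPlane.exists_is_const_of_deriv_eq_zero isPreconnected_cutPlane
    (fun z hz => (hderiv z hz).differentiableAt.differentiableWithinAt)
    fun z hz => (hderiv z hz).deriv
  calc W z = W 0 := (hk z hz).trans (hk 0 zero_mem_cutPlane).symm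
    _ = (1 - c) * (f 0 * g 0) := by
      simp only [W, eulerOp, sub_zero, Complex.one_cpow]
      ring

end Wronskian

section Parameters

variable {a b c : ℝ}

lemma two_sub_ne_intCast (hc : ∀ n : ℤ, c ≠ n) (n : ℤ) : 2 - c ≠ n := fun h =>
  hc (2 - n) (by push_cast; linarith)

lemma add_natCast_ne_intCast (hc : ∀ n : ℤ, c ≠ n) (k : ℕ) (n : ℤ) : c + k ≠ n := fun h =>
  hc (n - k) (by push_cast; linarith)

lemma add_one_ne_intCast (hc : ∀ n : ℤ, c ≠ n) (n : ℤ) : c + 1 ≠ n :=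
  mod_cast add_natCast_ne_intCast hc 1 n

lemma reflect_ne_intCast (hcab : ∀ n : ℤ, c - a - b ≠ n) (n : ℤ) : a + b - c + 1 ≠ n := fun h =>
  hcab (1 - n) (by push_cast; linarith)

end Parameters

section LocalSolutions

variable {a b c : ℝ} {φ : ℂ → ℂ} {Ω : Set ℂ}

lemma isHyperSol_powBranch_mul_gauss2F1 (a b : ℝ) (hc : ∀ n : ℤ, c ≠ n) (hΩ : IsOpen Ω)
    (hΩs : Ω ⊆ cutPlane) (hφ : IsPowBranch (1 - c) φ Ω) :
    IsHyperSol a b c (fun z => φ z * gauss2F1 (1 + a - c) (1 + b - c) (2 - c) z) Ω := by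
  have hg := (isHyperSol_gauss2F1 (1 + a - c) (1 + b - c) (two_sub_ne_intCast hc)).mono hΩs
  push_cast at hg
  exact hg.powBranch_mul hΩ hφ

lemma wronskian_powBranch_ne_zero (a b : ℝ) (hc : ∀ n : ℤ, c ≠ n) (hΩs : Ω ⊆ cutPlane)
    (hφ : IsPowBranch (1 - c) φ Ω) {z : ℂ} (hz : z ∈ Ω) :
    wronskian (gauss2F1 a b c)
      (fun w => φ w * gauss2F1 (1 + a - c) (1 + b - c) (2 - c) w) z ≠ 0 := by
  have hg := isHyperSol_gauss2F1 (1 + a - c) (1 + b - c) (two_sub_ne_intCast hc)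
  have hW := hg
  push_cast at hW
  have hred := reducedWronskian_eq (isHyperSol_gauss2F1 a b hc) hW (hΩs hz)
  rw [gauss2F1_zero a b hc, gauss2F1_zero _ _ (two_sub_ne_intCast hc), mul_one, mul_one,
    eulerOp] at hred
  have hz0 : z ≠ 0 := fun h => hφ.zero_notMem (h ▸ hz)
  rw [wronskian, ((hφ.hasDerivAt z hz).fun_mul
    (hg.analyticAt isOpen_cutPlane (hΩs hz)).differentiableAt.hasDerivAt).deriv]
  intro hw
  have hc1 : (1 : ℂ) - c ≠ 0 := sub_ne_zero.2 (mod_cast (hc 1).symm)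
  refine hc1 (hred ▸ mul_eq_zero_of_left (mul_left_cancel₀ (hφ.ne_zero z hz) ?_) _)
  field_simp at hw
  linear_combination hw

end LocalSolutions

/-- The plane cut along `(-∞, 0]` and `[1, ∞)`. -/
def doubleCutPlane : Set ℂ := cutPlane ∩ Complex.slitPlane

section DoubleCutPlane

variable {z : ℂ}

lemma mem_doubleCutPlane_iff : z ∈ doubleCutPlane ↔ z.im ≠ 0 ∨ (0 < z.re ∧ z.re < 1) := by
  rw [doubleCutPlane, Set.mem_inter_iff, Complex.mem_slitPlane_iff, cutPlane, Set.mem_ofPred_eq]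
  by_cases h : z.im = 0
  · simp [h, and_comm]
  · simp [h]

lemma isOpen_doubleCutPlane : IsOpen doubleCutPlane :=
  isOpen_cutPlane.inter Complex.isOpen_slitPlane

lemma half_mem_doubleCutPlane : (1 / 2 : ℂ) ∈ doubleCutPlane := by
  rw [mem_doubleCutPlane_iff]
  norm_num

lemma isPreconnected_doubleCutPlane : IsPreconnected doubleCutPlane := by
  have hstar : StarConvex ℝ (1 / 2 : ℂ) doubleCutPlane := by
    intro z hz s t hs ht hst
    rw [mem_doubleCutPlane_iff] at hz ⊢
    have him : (s • (1 / 2 : ℂ) + t • z).im = t * z.im := by simp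
    have hre : (s • (1 / 2 : ℂ) + t • z).re = s / 2 + t * z.re := by simp [div_eq_mul_inv]
    rw [him, hre]
    rcases ht.eq_or_lt with rfl | ht
    · exact Or.inr (by constructor <;> linarith)
    · exact hz.imp (mul_ne_zero ht.ne') fun ⟨_, _⟩ => by constructor <;> nlinarith
  exact (hstar.isPathConnected half_mem_doubleCutPlane).isConnected.isPreconnected

lemma doubleCutPlane_subset_cutPlane : doubleCutPlane ⊆ cutPlane := Set.inter_subset_left

lemma doubleCutPlane_subset_puncturedPlane : doubleCutPlane ⊆ puncturedPlane := by
  rintro z hz (rfl | rfl) <;> simp [mem_doubleCutPlane_iff] at hz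

lemma one_sub_mem_doubleCutPlane (hz : z ∈ doubleCutPlane) : 1 - z ∈ doubleCutPlane := by
  rw [mem_doubleCutPlane_iff] at hz ⊢
  simpa [and_comm] using hz

lemma ofReal_mem_doubleCutPlane {x : ℝ} (hx : x ∈ Set.Ioo 0 1) : (x : ℂ) ∈ doubleCutPlane :=
  mem_doubleCutPlane_iff.2 (Or.inr (by simpa using hx))

end DoubleCutPlane

section Connection

variable {a b c : ℝ} {z : ℂ}

lemma isPowBranch_cpow_doubleCutPlane (p : ℂ) :
    IsPowBranch p (fun z => z ^ p) doubleCutPlane :=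
  (isPowBranch_cpow p).mono Set.inter_subset_right

lemma isHyperSol_Fminus (a b : ℝ) (hc : ∀ n : ℤ, c ≠ n) :
    IsHyperSol a b c (Fminus a b c) cutPlane :=
  isHyperSol_gauss2F1 a b hc

lemma isHyperSol_Fplus (a b : ℝ) (hc : ∀ n : ℤ, c ≠ n) :
    IsHyperSol a b c (Fplus a b c) doubleCutPlane :=
  isHyperSol_powBranch_mul_gauss2F1 a b hc isOpen_doubleCutPlane doubleCutPlane_subset_cutPlane
    (isPowBranch_cpow_doubleCutPlane _)

lemma wronskian_Fminus_Fplus_ne_zero (a b : ℝ) (hc : ∀ n : ℤ, c ≠ n) (hz : z ∈ doubleCutPlane) :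
    wronskian (Fminus a b c) (Fplus a b c) z ≠ 0 :=
  wronskian_powBranch_ne_zero a b hc doubleCutPlane_subset_cutPlane
    (isPowBranch_cpow_doubleCutPlane _) hz

lemma isHyperSol_Fminus_reflect (hcab : ∀ n : ℤ, c - a - b ≠ n) :
    IsHyperSol a b c (fun z => Fminus a b (a + b - c + 1) (1 - z)) doubleCutPlane :=
  IsHyperSol.reflect (Ω := cutPlane)
    (by simpa only [Complex.ofReal_add, Complex.ofReal_sub, Complex.ofReal_one] using
      isHyperSol_Fminus a b (reflect_ne_intCast hcab))
    fun _ hz => doubleCutPlane_subset_cutPlane (one_sub_mem_doubleCutPlane hz)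

lemma isHyperSol_Fplus_reflect (hcab : ∀ n : ℤ, c - a - b ≠ n) :
    IsHyperSol a b c (fun z => Fplus a b (a + b - c + 1) (1 - z)) doubleCutPlane :=
  IsHyperSol.reflect (Ω := doubleCutPlane)
    (by simpa only [Complex.ofReal_add, Complex.ofReal_sub, Complex.ofReal_one] using
      isHyperSol_Fplus a b (reflect_ne_intCast hcab))
    fun _ hz => one_sub_mem_doubleCutPlane hz

lemma wronskian_reflect_Fminus_Fplus_ne_zero (hcab : ∀ n : ℤ, c - a - b ≠ n)
    (hz : z ∈ doubleCutPlane) :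
    wronskian (fun z => Fminus a b (a + b - c + 1) (1 - z))
      (fun z => Fplus a b (a + b - c + 1) (1 - z)) z ≠ 0 := by
  rw [wronskian_reflect]
  exact neg_ne_zero.2 (wronskian_Fminus_Fplus_ne_zero a b (reflect_ne_intCast hcab)
    (one_sub_mem_doubleCutPlane hz))

/-- `k₁`, `k₂` are the connection coefficients of `₂F₁(a, b, c, ·)`: its coordinates with respect
to the solutions at `1` with exponents `0` and `c - a - b`, which are the functions `F₋`, `F₊` of
`1 - z` with the parameter `c` replaced by `a + b - c + 1`. -/
def IsConnection (a b c : ℝ) (k₁ k₂ : ℂ) : Prop :=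
  ∀ z ∈ doubleCutPlane, gauss2F1 a b c z
    = k₁ * Fminus a b (a + b - c + 1) (1 - z) + k₂ * Fplus a b (a + b - c + 1) (1 - z)

lemma exists_isConnection (hc : ∀ n : ℤ, c ≠ n) (hcab : ∀ n : ℤ, c - a - b ≠ n) :
    ∃ k₁ k₂, IsConnection a b c k₁ k₂ :=
  IsHyperSol.exists_eq isOpen_doubleCutPlane isPreconnected_doubleCutPlane
    doubleCutPlane_subset_puncturedPlane (isHyperSol_Fminus_reflect hcab)
    (isHyperSol_Fplus_reflect hcab)
    (fun _ hz => wronskian_reflect_Fminus_Fplus_ne_zero hcab hz)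
    ((isHyperSol_Fminus a b hc).mono doubleCutPlane_subset_cutPlane)

lemma eq_of_eqOn_doubleCutPlane (hcab : ∀ n : ℤ, c - a - b ≠ n) {k₁ k₂ l₁ l₂ : ℂ}
    (h : ∀ z ∈ doubleCutPlane,
      k₁ * Fminus a b (a + b - c + 1) (1 - z) + k₂ * Fplus a b (a + b - c + 1) (1 - z)
        = l₁ * Fminus a b (a + b - c + 1) (1 - z) + l₂ * Fplus a b (a + b - c + 1) (1 - z)) :
    k₁ = l₁ ∧ k₂ = l₂ := by
  have hzero := eq_zero_of_wronskian_ne_zero (k₁ := k₁ - l₁) (k₂ := k₂ - l₂)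
    ((isHyperSol_Fminus_reflect hcab).analyticAt isOpen_doubleCutPlane half_mem_doubleCutPlane)
    ((isHyperSol_Fplus_reflect hcab).analyticAt isOpen_doubleCutPlane half_mem_doubleCutPlane)
    (wronskian_reflect_Fminus_Fplus_ne_zero hcab half_mem_doubleCutPlane) (by
      filter_upwards [isOpen_doubleCutPlane.mem_nhds half_mem_doubleCutPlane] with z hz
      linear_combination h z hz)
  exact hzero.imp sub_eq_zero.1 sub_eq_zero.1

lemma IsConnection.unique (hcab : ∀ n : ℤ, c - a - b ≠ n) {k₁ k₂ l₁ l₂ : ℂ}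
    (hk : IsConnection a b c k₁ k₂) (hl : IsConnection a b c l₁ l₂) : k₁ = l₁ ∧ k₂ = l₂ :=
  eq_of_eqOn_doubleCutPlane hcab fun z hz => (hk z hz).symm.trans (hl z hz)

end Connection

section Contiguous

lemma ordinaryHypergeometricCoefficient_deriv (a b c : ℂ) (n : ℕ) :
    (n + 1) * ordinaryHypergeometricCoefficient a b c (n + 1)
      = a * b / c * ordinaryHypergeometricCoefficient (a + 1) (b + 1) (c + 1) n := by
  have hn : (n : ℂ) + 1 ≠ 0 := n.cast_add_one_ne_zero
  have hasc (x : ℂ) : (ascPochhammer ℂ (n + 1)).eval x = x * (ascPochhammer ℂ n).eval (x + 1) := by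
    simp [ascPochhammer_succ_left]
  simp only [ordinaryHypergeometricCoefficient, hasc, Nat.factorial_succ, Nat.cast_mul,
    Nat.cast_succ, mul_inv]
  field_simp

lemma ordinaryHypergeometricCoefficient_add_one (a b : ℂ) {c : ℂ} (hc : ∀ n : ℕ, (n : ℂ) + c ≠ 0)
    (n : ℕ) :
    (n + c) * ordinaryHypergeometricCoefficient a b (c + 1) n
      = c * ordinaryHypergeometricCoefficient a b c n := by
  have hasc : (ascPochhammer ℂ n).eval c * (c + n) = c * (ascPochhammer ℂ n).eval (c + 1) := by
    rw [← ascPochhammer_succ_eval]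
    simp [ascPochhammer_succ_left]
  have hc0 : c ≠ 0 := by simpa using hc 0
  have hcn : c + n ≠ 0 := add_comm (n : ℂ) c ▸ hc n
  have hinv : ((ascPochhammer ℂ n).eval (c + 1))⁻¹
      = c / (c + n) * ((ascPochhammer ℂ n).eval c)⁻¹ := by
    rw [eq_div_of_mul_eq hcn hasc]
    field_simp
  simp only [ordinaryHypergeometricCoefficient, hinv]
  rw [add_comm (n : ℂ)]
  field_simp

lemma eqOn_cutPlane_of_taylorCoeff_eq {f g : ℂ → ℂ} (hf : AnalyticOnNhd ℂ f cutPlane)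
    (hg : AnalyticOnNhd ℂ g cutPlane) (h : taylorCoeff f = taylorCoeff g) :
    Set.EqOn f g cutPlane :=
  hf.eqOn_of_preconnected_of_eventuallyEq hg isPreconnected_cutPlane zero_mem_cutPlane
    (eventuallyEq_of_taylorCoeff_eq (hf 0 zero_mem_cutPlane) (hg 0 zero_mem_cutPlane) h)

variable {a b c : ℝ} {z : ℂ}

lemma analyticOnNhd_gauss2F1 (a b : ℝ) (hc : ∀ n : ℤ, c ≠ n) :
    AnalyticOnNhd ℂ (gauss2F1 a b c) cutPlane := fun _ hz =>
  (isHyperSol_gauss2F1 a b hc).analyticAt isOpen_cutPlane hz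

lemma deriv_gauss2F1 (a b : ℝ) (hc : ∀ n : ℤ, c ≠ n) (hz : z ∈ cutPlane) :
    deriv (gauss2F1 a b c) z = a * b / c * gauss2F1 (a + 1) (b + 1) (c + 1) z := by
  refine eqOn_cutPlane_of_taylorCoeff_eq (g := fun z => a * b / c * gauss2F1 _ _ _ z)
    (analyticOnNhd_gauss2F1 a b hc).deriv
    (analyticOnNhd_const.mul (analyticOnNhd_gauss2F1 (a + 1) (b + 1) (add_one_ne_intCast hc)))
    (funext fun n => ?_) hz
  rw [taylorCoeff_deriv, taylorCoeff_const_mul, taylorCoeff_gauss2F1 a b hc,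
    taylorCoeff_gauss2F1 _ _ (add_one_ne_intCast hc)]
  push_cast
  exact ordinaryHypergeometricCoefficient_deriv a b c n

lemma eulerOp_gauss2F1 (a b : ℝ) (hc : ∀ n : ℤ, c ≠ n) (hz : z ∈ cutPlane) :
    eulerOp c (gauss2F1 a b (c + 1)) z = c * gauss2F1 a b c z := by
  have hF := analyticOnNhd_gauss2F1 a b (add_one_ne_intCast hc)
  refine eqOn_cutPlane_of_taylorCoeff_eq (g := fun z => c * gauss2F1 a b c z)
    (fun w hw => analyticAt_eulerOp _ (hF w hw))
    (analyticOnNhd_const.mul (analyticOnNhd_gauss2F1 a b hc)) (funext fun n => ?_) hz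
  rw [taylorCoeff_eulerOp _ (hF 0 zero_mem_cutPlane), taylorCoeff_const_mul,
    taylorCoeff_gauss2F1 a b hc, taylorCoeff_gauss2F1 a b (add_one_ne_intCast hc)]
  push_cast
  exact ordinaryHypergeometricCoefficient_add_one a b (natCast_add_ofReal_ne_zero hc) n

lemma hasDerivAt_Fminus (a b : ℝ) (hc : ∀ n : ℤ, c ≠ n) (hz : z ∈ cutPlane) :
    HasDerivAt (Fminus a b c) (a * b / c * Fminus (a + 1) (b + 1) (c + 1) z) z :=
  ((analyticOnNhd_gauss2F1 a b hc) z hz).differentiableAt.hasDerivAt.congr_deriv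
    (deriv_gauss2F1 a b hc hz)

lemma hasDerivAt_Fplus (a b : ℝ) (hc : ∀ n : ℤ, c ≠ n) (hz : z ∈ doubleCutPlane) :
    HasDerivAt (Fplus a b c) ((1 - c) * Fplus (a + 1) (b + 1) (c + 1) z) z := by
  have hc1 : ∀ n : ℤ, 1 - c ≠ n := fun n h => hc (1 - n) (by push_cast; linarith)
  have hg := analyticOnNhd_gauss2F1 (1 + a - c) (1 + b - c) (two_sub_ne_intCast hc) z hz.1
  have heuler := eulerOp_gauss2F1 (1 + a - c) (1 + b - c) hc1 hz.1
  rw [show 1 - c + 1 = 2 - c by ring, eulerOp] at heuler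
  refine ((hasDerivAt_cpow_const_div (1 - (c : ℂ)) hz.2).fun_mul
    hg.differentiableAt.hasDerivAt).congr_deriv ?_
  have hz0 := Complex.slitPlane_ne_zero hz.2
  have hpow : z ^ (1 - (c : ℂ)) = z * z ^ (-(c : ℂ)) := by
    rw [sub_eq_add_neg, Complex.cpow_add _ _ hz0, Complex.cpow_one]
  rw [Fplus, show 1 + (a + 1) - (c + 1) = 1 + a - c by ring,
    show 1 + (b + 1) - (c + 1) = 1 + b - c by ring, show 2 - (c + 1) = 1 - c by ring,
    show 1 - ((c + 1 : ℝ) : ℂ) = -c by push_cast; ring, hpow]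
  push_cast at heuler
  rw [mul_left_comm, mul_div_cancel_left₀ _ hz0]
  linear_combination z ^ (-(c : ℂ)) * heuler

lemma Fplus_reflect_eq (a b c : ℝ) (z : ℂ) :
    Fplus a b (a + b - c + 1) z
      = z ^ ((c : ℂ) - a - b) * gauss2F1 (c - a) (c - b) (c - a - b + 1) z := by
  rw [Fplus, gauss2F1_symm]
  congr 2
  · push_cast
    ring
  · ring
  all_goals ring

end Contiguous

section ConnectionRelations

variable {a b c : ℝ} {k₁ k₂ l₁ l₂ : ℂ}

lemma IsConnection.succ (hc : ∀ n : ℤ, c ≠ n) (hcab : ∀ n : ℤ, c - a - b ≠ n)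
    (hk : IsConnection a b c k₁ k₂) (hl : IsConnection (a + 1) (b + 1) (c + 1) l₁ l₂) :
    a * b * l₂ = c * (a + b - c) * k₂ := by
  have hs := reflect_ne_intCast hcab
  have hcab' : ∀ n : ℤ, c + 1 - (a + 1) - (b + 1) ≠ n := fun n h =>
    hcab (n + 1) (by push_cast; linarith)
  have hshift : a + 1 + (b + 1) - (c + 1) + 1 = a + b - c + 1 + 1 := by ring
  have hderiv : ∀ z ∈ doubleCutPlane, a * b / c * gauss2F1 (a + 1) (b + 1) (c + 1) z
      = k₁ * -(a * b / (a + b - c + 1) * Fminus (a + 1) (b + 1) (a + b - c + 1 + 1) (1 - z))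
        + k₂ * -((c - a - b) * Fplus (a + 1) (b + 1) (a + b - c + 1 + 1) (1 - z)) := by
    intro z hz
    have hz' := one_sub_mem_doubleCutPlane hz
    have hright := (((hasDerivAt_Fminus a b hs hz'.1).comp_const_sub 1 z).const_mul k₁).fun_add
      (((hasDerivAt_Fplus a b hs hz').comp_const_sub 1 z).const_mul k₂)
    have hleft := (hasDerivAt_Fminus a b hc hz.1).congr_of_eventuallyEq
      (eventually_of_mem (isOpen_doubleCutPlane.mem_nhds hz) fun w hw => (hk w hw).symm)
    have := hleft.unique hright
    rw [Fminus] at this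
    rw [this]
    push_cast
    ring
  have hc0 : (c : ℂ) ≠ 0 := mod_cast hc 0
  have hcoeff := (eq_of_eqOn_doubleCutPlane (k₁ := a * b / c * l₁) (k₂ := a * b / c * l₂)
    (l₁ := -(a * b / (a + b - c + 1)) * k₁) (l₂ := (a + b - c) * k₂) hcab' fun z hz => by
      have h₁ := hderiv z hz
      rw [hl z hz] at h₁
      rw [hshift] at h₁ ⊢
      linear_combination h₁).2
  field_simp at hcoeff
  linear_combination hcoeff

lemma IsConnection.euler (hc : ∀ n : ℤ, c ≠ n) (hk : IsConnection a b c k₁ k₂) :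
    IsConnection (c - a) (c - b) c k₂ k₁ := by
  intro z hz
  have hinv : (1 - z) ^ ((a : ℂ) + b - c) * (1 - z) ^ ((c : ℂ) - a - b) = 1 := by
    have hz0 := Complex.slitPlane_ne_zero (one_sub_mem_doubleCutPlane hz).2
    rw [← Complex.cpow_add _ _ hz0, show (a : ℂ) + b - c + (c - a - b) = 0 by ring,
      Complex.cpow_zero]
  have heuler := gauss2F1_euler (c - a) (c - b) hc hz.1
  rw [sub_sub_cancel, sub_sub_cancel, hk z hz, Fplus_reflect_eq] at heuler
  rw [heuler, Fplus_reflect_eq, sub_sub_cancel, sub_sub_cancel, Fminus, Fminus,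
    show c - a + (c - b) - c + 1 = c - a - b + 1 by ring,
    show a - (c - b) + 1 = a + b - c + 1 by ring]
  push_cast
  rw [show (c : ℂ) - (c - a) - (c - b) = a + b - c by ring]
  linear_combination k₂ * gauss2F1 (c - a) (c - b) (c - a - b + 1) (1 - z) * hinv

lemma IsConnection.contiguous (hc : ∀ n : ℤ, c ≠ n) (hcab : ∀ n : ℤ, c - a - b ≠ n)
    (hk : IsConnection a b c k₁ k₂) (hl : IsConnection a b (c + 1) l₁ l₂) :
    (c - a) * (c - b) * l₁ = c * (c - a - b) * k₁ := by
  have hl' := hl.euler (add_one_ne_intCast hc)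
  rw [add_sub_right_comm c 1 a, add_sub_right_comm c 1 b] at hl'
  have h := (hk.euler hc).succ hc (fun n h => hcab (-n) (by push_cast; linarith)) hl'
  push_cast at h
  linear_combination h

end ConnectionRelations

section LargeParameter

lemma norm_ordinaryHypergeometricCoefficient_succ_le {a b c m : ℝ} (ha : |a| ≤ m) (hb : |b| ≤ m)
    (hc : 0 < c) (n : ℕ) :
    (n + 1) * (n + c) * ‖ordinaryHypergeometricCoefficient (a : ℂ) b c (n + 1)‖
      ≤ (n + m) ^ 2 * ‖ordinaryHypergeometricCoefficient (a : ℂ) b c n‖ := by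
  have hne (k : ℕ) : (k : ℂ) + (c : ℂ) ≠ 0 := by
    have : (k : ℝ) + c ≠ 0 := by positivity
    exact_mod_cast this
  have hnorm (x : ℝ) : ‖(n : ℂ) + x‖ = |(n : ℝ) + x| := by
    rw [← Complex.ofReal_natCast, ← Complex.ofReal_add, Complex.norm_real, Real.norm_eq_abs]
  have hle (x : ℝ) (hx : |x| ≤ m) : |(n : ℝ) + x| ≤ n + m :=
    (abs_add_le _ _).trans (by rw [Nat.abs_cast]; gcongr)
  have hrec := congrArg norm (ordinaryHypergeometricCoefficient_succ (a := a) (b := b) hne n)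
  rw [norm_mul (_ * _) (ordinaryHypergeometricCoefficient _ _ _ (n + 1)),
    norm_mul (_ * _) (ordinaryHypergeometricCoefficient _ _ _ n), norm_mul (_ + _),
    norm_mul (_ + _), ← Complex.ofReal_one, hnorm, hnorm, hnorm, hnorm,
    abs_of_pos (by positivity : 0 < (n : ℝ) + 1),
    abs_of_pos (by positivity : 0 < (n : ℝ) + c)] at hrec
  rw [hrec, sq]
  gcongr
  · exact (abs_nonneg _).trans (hle a ha)
  · exact hle a ha
  · exact hle b hb

/-- If `c` dominates `m ^ 2`, then `(n + m) ^ 2 + c / 2 ≤ n (n - 1 + c)` for `n ≥ 1`, so that the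
recursion for the coefficients telescopes. -/
lemma sum_norm_ordinaryHypergeometricCoefficient_le {a b c m : ℝ} (ha : |a| ≤ m) (hb : |b| ≤ m)
    (hc : 2 * (m + 1) ^ 2 ≤ c) (N : ℕ) :
    ∑ n ∈ Finset.range N, ‖ordinaryHypergeometricCoefficient (a : ℂ) b c (n + 1)‖
      ≤ 2 * m ^ 2 / c := by
  have hm : 0 ≤ m := (abs_nonneg a).trans ha
  have hc0 : 0 < c := lt_of_lt_of_le (by positivity) hc
  set u : ℕ → ℝ := fun n => ‖ordinaryHypergeometricCoefficient (a : ℂ) b c n‖ with hu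
  have hu0 (n : ℕ) : 0 ≤ u n := norm_nonneg _
  have hrec (n : ℕ) : (n + 1) * (n + c) * u (n + 1) ≤ (n + m) ^ 2 * u n :=
    norm_ordinaryHypergeometricCoefficient_succ_le ha hb hc0 n
  have htelescope : ∀ N : ℕ, c / 2 * ∑ n ∈ Finset.range N, u (n + 1)
      + (N + 1) * (N + c) * u (N + 1) ≤ m ^ 2 := by
    intro N
    induction N with
    | zero => simpa [hu] using hrec 0
    | succ N ih =>
      have hstep : c / 2 + (N + 1 + m) ^ 2 ≤ (N + 1) * (N + c) := by
        have hN : (0 : ℝ) ≤ N := N.cast_nonneg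
        nlinarith [mul_nonneg hN (sub_nonneg.2 hc), mul_nonneg hN (sq_nonneg m)]
      have h := hrec (N + 1)
      rw [Finset.sum_range_succ]
      push_cast at h ⊢
      nlinarith [mul_le_mul_of_nonneg_right hstep (hu0 (N + 1))]
  rw [le_div_iff₀ hc0]
  have hlast : 0 ≤ (N + 1) * (N + c) * u (N + 1) := mul_nonneg (by positivity) (hu0 _)
  linarith [htelescope N]

lemma norm_gauss2F1_sub_one_le {a b c m : ℝ} (ha : |a| ≤ m) (hb : |b| ≤ m)
    (hcm : 2 * (m + 1) ^ 2 ≤ c) (hc : ∀ n : ℤ, c ≠ n) {z : ℂ} (hz : z ∈ Metric.ball 0 1) :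
    ‖gauss2F1 a b c z - 1‖ ≤ 2 * m ^ 2 / c := by
  have htail := (hasSum_nat_add_iff' 1).2 (hasSum_taylorCoeff
    ((isHyperSol_gauss2F1 a b hc).differentiableOn.mono ball_subset_cutPlane) hz)
  simp only [Finset.sum_range_one, pow_zero, mul_one, taylorCoeff_zero, gauss2F1_zero a b hc]
    at htail
  have hbound := sum_norm_ordinaryHypergeometricCoefficient_le ha hb hcm
  have hsum := summable_of_sum_range_le (fun _ => norm_nonneg _) hbound
  refine (htail.norm_le_of_bounded hsum.hasSum fun n => ?_).trans
    (Real.tsum_le_of_sum_range_le (fun _ => norm_nonneg _) hbound)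
  rw [taylorCoeff_gauss2F1 a b hc, norm_mul, norm_pow]
  exact mul_le_of_le_one_right (norm_nonneg _)
    (pow_le_one₀ (norm_nonneg _) (mem_ball_zero_iff.1 hz).le)

end LargeParameter

section ConnectionCoefficients

variable {a b c : ℝ} {k₁ k₂ : ℂ}

lemma IsConnection.tendsto (hcab : ∀ n : ℤ, c - a - b ≠ n) (hpos : 0 < c - a - b)
    (h : IsConnection a b c k₁ k₂) :
    Tendsto (fun x : ℝ => gauss2F1 a b c x) (𝓝[<] 1) (𝓝 k₁) := by
  have ht : Tendsto (fun x : ℝ => 1 - (x : ℂ)) (𝓝[<] 1) (𝓝 0) := by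
    have hcont : Continuous fun x : ℝ => 1 - (x : ℂ) := by fun_prop
    simpa using (hcont.tendsto 1).mono_left nhdsWithin_le_nhds
  have hminus : Tendsto (Fminus a b (a + b - c + 1)) (𝓝 0) (𝓝 1) := by
    have := (isHyperSol_Fminus a b (reflect_ne_intCast hcab)).analyticAt isOpen_cutPlane
      zero_mem_cutPlane |>.continuousAt.tendsto
    rwa [Fminus, gauss2F1_zero _ _ (reflect_ne_intCast hcab)] at this
  have hplus : Tendsto (Fplus a b (a + b - c + 1)) (𝓝 0) (𝓝 0) := by
    have hre : 0 < (1 - ((a + b - c + 1 : ℝ) : ℂ)).re := by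
      rw [← Complex.ofReal_one, ← Complex.ofReal_sub, Complex.ofReal_re]
      linarith
    have hne : 1 - ((a + b - c + 1 : ℝ) : ℂ) ≠ 0 := fun h => by
      rw [h, Complex.zero_re] at hre
      exact hre.false
    have hpow := (Complex.continuousAt_cpow_const_of_re_pos (z := 0) (by simp) hre).tendsto
    rw [Complex.zero_cpow hne] at hpow
    have hg := (analyticOnNhd_gauss2F1 (1 + a - (a + b - c + 1)) (1 + b - (a + b - c + 1))
      (two_sub_ne_intCast (reflect_ne_intCast hcab)) 0 zero_mem_cutPlane).continuousAt.tendsto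
    have hmul := hpow.mul hg
    rw [zero_mul] at hmul
    exact hmul
  have hlim := ((hminus.comp ht).const_mul k₁).add ((hplus.comp ht).const_mul k₂)
  rw [mul_one, mul_zero, add_zero] at hlim
  refine hlim.congr' ?_
  filter_upwards [Ioo_mem_nhdsLT zero_lt_one] with x hx
  exact (h x (ofReal_mem_doubleCutPlane hx)).symm

/-- The quotient `Γ(c) Γ(c - a - b) / (Γ(c - a) Γ(c - b))` of Gauss's summation theorem, with the
convention `1 / Γ = 0` at the poles of `Γ` as in `coeffMinus`. -/
def gammaRatio (a b c : ℝ) : ℝ :=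
  Real.Gamma c * Real.Gamma (c - a - b) / (Real.Gamma (c - a) * Real.Gamma (c - b))

lemma tendsto_inv_GammaSeq (s : ℝ) :
    Tendsto (fun n => (Real.GammaSeq s n)⁻¹) atTop (𝓝 (Real.Gamma s)⁻¹) := by
  by_cases h : Real.Gamma s = 0
  · obtain ⟨m, rfl⟩ := (Real.Gamma_eq_zero_iff s).1 h
    rw [h]
    refine tendsto_const_nhds.congr' ?_
    filter_upwards [eventually_ge_atTop m] with n hn
    rw [Real.GammaSeq, Finset.prod_eq_zero (i := m) (by simpa [Nat.lt_succ_iff] using hn)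
      (by simp), div_zero]
  · exact (Real.GammaSeq_tendsto_Gamma s).inv₀ h

lemma GammaSeq_mul_div_GammaSeq_mul (a b c : ℝ) {n : ℕ} (hn : 0 < n) :
    Real.GammaSeq c n * Real.GammaSeq (c - a - b) n
        * (Real.GammaSeq (c - a) n)⁻¹ * (Real.GammaSeq (c - b) n)⁻¹
      = ∏ j ∈ Finset.range (n + 1),
        (c - a + j) * (c - b + j) / ((c + j) * (c - a - b + j)) := by
  have hn' : (0 : ℝ) < n := mod_cast hn
  have hpow : (n : ℝ) ^ c * (n : ℝ) ^ (c - a - b) = (n : ℝ) ^ (c - a) * (n : ℝ) ^ (c - b) := by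
    rw [← Real.rpow_add hn', ← Real.rpow_add hn']
    congr 1
    ring
  have hfact : (n.factorial : ℝ) ≠ 0 := mod_cast n.factorial_ne_zero
  have hpos (s : ℝ) : (n : ℝ) ^ s ≠ 0 := (Real.rpow_pos_of_pos hn' s).ne'
  have ha := hpos (c - a)
  have hb := hpos (c - b)
  simp only [Real.GammaSeq, Finset.prod_div_distrib, Finset.prod_mul_distrib, inv_div]
  calc _ = (n : ℝ) ^ c * (n : ℝ) ^ (c - a - b) / ((n : ℝ) ^ (c - a) * (n : ℝ) ^ (c - b))
        * (n.factorial / n.factorial) ^ 2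
        * ((∏ j ∈ Finset.range (n + 1), (c - a + j)) * (∏ j ∈ Finset.range (n + 1), (c - b + j))
        / ((∏ j ∈ Finset.range (n + 1), (c + j))
          * ∏ j ∈ Finset.range (n + 1), (c - a - b + j))) := by ring
    _ = _ := by rw [hpow, div_self (mul_ne_zero ha hb), div_self hfact, one_pow, one_mul, one_mul]

lemma tendsto_prod_gammaRatio (a b c : ℝ) :
    Tendsto (fun n : ℕ => ∏ j ∈ Finset.range (n + 1),
      (c - a + j) * (c - b + j) / ((c + j) * (c - a - b + j))) atTop (𝓝 (gammaRatio a b c)) := by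
  have h := (((Real.GammaSeq_tendsto_Gamma c).mul (Real.GammaSeq_tendsto_Gamma (c - a - b))).mul
    (tendsto_inv_GammaSeq (c - a))).mul (tendsto_inv_GammaSeq (c - b))
  rw [mul_assoc, ← mul_inv, ← div_eq_mul_inv] at h
  refine h.congr' ?_
  filter_upwards [eventually_gt_atTop 0] with n hn
  exact GammaSeq_mul_div_GammaSeq_mul a b c hn

lemma add_natCast_sub_sub_ne_intCast (hcab : ∀ n : ℤ, c - a - b ≠ n) (k : ℕ) (n : ℤ) :
    c + k - a - b ≠ n := fun h =>
  add_natCast_ne_intCast hcab k n (by linarith)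

lemma IsConnection.eq_mul_prod (hc : ∀ n : ℤ, c ≠ n) (hcab : ∀ n : ℤ, c - a - b ≠ n)
    (h : IsConnection a b c k₁ k₂) (N : ℕ) {l₁ l₂ : ℂ} (hl : IsConnection a b (c + N) l₁ l₂) :
    k₁ = l₁ * (∏ j ∈ Finset.range N,
      (c - a + j) * (c - b + j) / ((c + j) * (c - a - b + j)) : ℝ) := by
  induction N generalizing l₁ l₂ with
  | zero => simpa using (h.unique hcab (by simpa using hl)).1
  | succ N ih =>
    have hcN := add_natCast_ne_intCast hc N
    have hcabN := add_natCast_sub_sub_ne_intCast hcab N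
    obtain ⟨m₁, m₂, hm⟩ := exists_isConnection hcN hcabN
    rw [Nat.cast_succ, ← add_assoc] at hl
    have hstep := hm.contiguous hcN hcabN hl
    have hcN0 : (c : ℂ) + N ≠ 0 := mod_cast hcN 0
    have hcabN0 : (c : ℂ) - a - b + N ≠ 0 := by
      have := hcabN 0
      rw [show c + N - a - b = c - a - b + N by ring] at this
      exact_mod_cast this
    rw [ih hm, Finset.prod_range_succ]
    push_cast at hstep ⊢
    have hm₁ : m₁ = l₁ * ((c - a + N) * (c - b + N) / ((c + N) * (c - a - b + N))) := by
      field_simp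
      linear_combination -hstep
    rw [hm₁]
    ring

lemma tendsto_fst_of_isConnection (hc : ∀ n : ℤ, c ≠ n) (hcab : ∀ n : ℤ, c - a - b ≠ n)
    {κ₁ κ₂ : ℕ → ℂ} (hκ : ∀ N : ℕ, IsConnection a b (c + N) (κ₁ N) (κ₂ N)) :
    Tendsto κ₁ atTop (𝓝 1) := by
  set m := max |a| |b|
  have hcN : Tendsto (fun N : ℕ => c + N) atTop atTop :=
    tendsto_atTop_add_const_left _ _ tendsto_natCast_atTop_atTop
  rw [tendsto_iff_norm_sub_tendsto_zero]
  refine squeeze_zero' (Eventually.of_forall fun _ => norm_nonneg _) ?_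
    (hcN.const_div_atTop (2 * m ^ 2))
  filter_upwards [hcN.eventually_ge_atTop (2 * (m + 1) ^ 2), hcN.eventually_gt_atTop (a + b)]
    with N hNm hNab
  have hlim := ((hκ N).tendsto (add_natCast_sub_sub_ne_intCast hcab N)
    (by linarith)).sub_const 1 |>.norm
  refine le_of_tendsto hlim ?_
  filter_upwards [Ioo_mem_nhdsLT zero_lt_one] with x hx
  refine norm_gauss2F1_sub_one_le (le_max_left _ _) (le_max_right _ _) hNm
    (add_natCast_ne_intCast hc N) ?_
  rw [mem_ball_zero_iff, Complex.norm_real, Real.norm_eq_abs, abs_of_pos hx.1]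
  exact hx.2

lemma IsConnection.fst_eq (hc : ∀ n : ℤ, c ≠ n) (hcab : ∀ n : ℤ, c - a - b ≠ n)
    (h : IsConnection a b c k₁ k₂) : k₁ = gammaRatio a b c := by
  choose κ₁ κ₂ hκ using fun N : ℕ =>
    exists_isConnection (add_natCast_ne_intCast hc N) (add_natCast_sub_sub_ne_intCast hcab N)
  have hlim := ((tendsto_fst_of_isConnection hc hcab hκ).comp (tendsto_add_atTop_nat 1)).mul
    ((Complex.continuous_ofReal.tendsto _).comp (tendsto_prod_gammaRatio a b c))
  rw [one_mul] at hlim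
  exact tendsto_nhds_unique (tendsto_const_nhds.congr fun N =>
    h.eq_mul_prod hc hcab (N + 1) (hκ (N + 1))) hlim

lemma isConnection_gammaRatio (hc : ∀ n : ℤ, c ≠ n) (hcab : ∀ n : ℤ, c - a - b ≠ n) :
    IsConnection a b c (gammaRatio a b c) (gammaRatio (c - a) (c - b) c) := by
  have hcab' : ∀ n : ℤ, c - (c - a) - (c - b) ≠ n := fun n h => hcab (-n) (by push_cast; linarith)
  obtain ⟨k₁, k₂, hk⟩ := exists_isConnection hc hcab
  rw [← hk.fst_eq hc hcab, ← (hk.euler hc).fst_eq hc hcab']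
  exact hk

lemma Fplus_connection (hc : ∀ n : ℤ, c ≠ n) (hcab : ∀ n : ℤ, c - a - b ≠ n) {z : ℂ}
    (hz : z ∈ doubleCutPlane) :
    Fplus a b c z = gammaRatio (1 + a - c) (1 + b - c) (2 - c) * Fminus a b (a + b - c + 1) (1 - z)
      + gammaRatio (1 - a) (1 - b) (2 - c) * Fplus a b (a + b - c + 1) (1 - z) := by
  have hs := reflect_ne_intCast hcab
  have hz' := one_sub_mem_doubleCutPlane hz
  have hconn := isConnection_gammaRatio (a := 1 + a - c) (b := 1 + b - c) (two_sub_ne_intCast hc)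
    (fun n h => hcab n (by linarith)) z hz
  rw [show 1 + a - c + (1 + b - c) - (2 - c) + 1 = a + b - c + 1 by ring,
    show 2 - c - (1 + a - c) = 1 - a by ring, show 2 - c - (1 + b - c) = 1 - b by ring] at hconn
  have hminus : Fminus a b (a + b - c + 1) (1 - z)
      = z ^ (1 - (c : ℂ)) * Fminus (1 + a - c) (1 + b - c) (a + b - c + 1) (1 - z) := by
    have heuler := gauss2F1_euler b a hs hz'.1
    rw [gauss2F1_symm, sub_sub_cancel, show a + b - c + 1 - b = 1 + a - c by ring,
      show a + b - c + 1 - a = 1 + b - c by ring] at heuler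
    rw [Fminus, Fminus, heuler]
    congr 2
    push_cast
    ring
  have hplus : Fplus a b (a + b - c + 1) (1 - z)
      = z ^ (1 - (c : ℂ)) * Fplus (1 + a - c) (1 + b - c) (a + b - c + 1) (1 - z) := by
    have heuler := gauss2F1_euler (c - b) (c - a) (add_one_ne_intCast hcab) hz'.1
    have hrefl := Fplus_reflect_eq (1 + a - c) (1 + b - c) (2 - c) (1 - z)
    rw [show 1 + a - c + (1 + b - c) - (2 - c) + 1 = a + b - c + 1 by ring] at hrefl
    rw [Fplus_reflect_eq, gauss2F1_symm, heuler, hrefl, sub_sub_cancel, mul_left_comm]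
    congr 2
    · push_cast
      ring
    · congr 1
      push_cast
      ring
    · congr 1 <;> ring
  rw [Fplus, hconn, hminus, hplus]
  ring

end ConnectionCoefficients

section Wirtinger

variable {f f₁ f₂ g g₁ g₂ : ℂ → ℂ} {z : ℂ}

lemma dz_eq_deriv (h : DifferentiableAt ℂ f z) : dz f z = deriv f z := by
  rw [dz, (h.hasDerivAt.hasFDerivAt.restrictScalars ℝ).fderiv]
  simp only [ContinuousLinearMap.coe_restrictScalars', ContinuousLinearMap.toSpanSingleton_apply,
    smul_eq_mul, one_mul]
  linear_combination (-deriv f z / 2) * Complex.I_mul_I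

lemma dz_mul (hf : DifferentiableAt ℝ f z) (hg : DifferentiableAt ℝ g z) :
    dz (fun w => f w * g w) z = dz f z * g z + f z * dz g z := by
  unfold dz
  rw [fderiv_fun_mul hf hg]
  simp only [add_apply, smul_apply, smul_eq_mul]
  ring

lemma dz_sub (hf : DifferentiableAt ℝ f z) (hg : DifferentiableAt ℝ g z) :
    dz (fun w => f w - g w) z = dz f z - dz g z := by
  unfold dz
  rw [fderiv_fun_sub hf hg]
  simp only [sub_apply]
  ring

lemma differentiableAt_conj (hf : DifferentiableAt ℝ f z) :
    DifferentiableAt ℝ (fun w => conj (f w)) z :=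
  Complex.conjCLE.differentiableAt.comp z hf

lemma fderiv_conj (hf : DifferentiableAt ℝ f z) (v : ℂ) :
    fderiv ℝ (fun w => conj (f w)) z v = conj (fderiv ℝ f z v) :=
  congrArg (· v)
    ((Complex.conjCLE.toContinuousLinearMap.hasFDerivAt (x := f z)).comp z hf.hasFDerivAt).fderiv

lemma dz_conj_eq_zero (h : DifferentiableAt ℂ f z) : dz (fun w => conj (f w)) z = 0 := by
  have hf := h.restrictScalars ℝ
  rw [dz, fderiv_conj hf, fderiv_conj hf, (h.hasDerivAt.hasFDerivAt.restrictScalars ℝ).fderiv]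
  simp only [ContinuousLinearMap.coe_restrictScalars', ContinuousLinearMap.toSpanSingleton_apply,
    smul_eq_mul, one_mul, map_mul, Complex.conj_I]
  linear_combination (conj (deriv f z) / 2) * Complex.I_mul_I

lemma differentiableAt_conj_of_dz_eq_zero (hf : DifferentiableAt ℝ f z) (h : dz f z = 0) :
    DifferentiableAt ℂ (fun w => conj (f w)) z := by
  rw [differentiableAt_complex_iff_differentiableAt_real]
  refine ⟨differentiableAt_conj hf, ?_⟩
  have hI : fderiv ℝ f z Complex.I = -Complex.I * fderiv ℝ f z 1 := by
    rw [dz] at h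
    linear_combination (2 * Complex.I) * h + fderiv ℝ f z Complex.I * Complex.I_mul_I
  rw [fderiv_conj hf, fderiv_conj hf, hI, map_mul, map_neg, Complex.conj_I, neg_neg, smul_eq_mul]

lemma dz_mul_conj_add (hg₁ : DifferentiableAt ℂ g₁ z) (hg₂ : DifferentiableAt ℂ g₂ z)
    (hf₁ : DifferentiableAt ℂ f₁ z) (hf₂ : DifferentiableAt ℂ f₂ z) :
    dz (fun w => g₁ w * conj (f₁ w) + g₂ w * conj (f₂ w)) z
      = deriv g₁ z * conj (f₁ z) + deriv g₂ z * conj (f₂ z) := by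
  have hg₁' := hg₁.restrictScalars ℝ
  have hg₂' := hg₂.restrictScalars ℝ
  have hf₁' := differentiableAt_conj (hf₁.restrictScalars ℝ)
  have hf₂' := differentiableAt_conj (hf₂.restrictScalars ℝ)
  rw [dz_add (hg₁'.fun_mul hf₁') (hg₂'.fun_mul hf₂'), dz_mul hg₁' hf₁', dz_mul hg₂' hf₂',
    dz_conj_eq_zero hf₁, dz_conj_eq_zero hf₂, dz_eq_deriv hg₁, dz_eq_deriv hg₂, mul_zero,
    mul_zero, add_zero, add_zero]

lemma eq_zero_of_mul_conj_add_eq_zero (hg₁ : DifferentiableAt ℂ g₁ z)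
    (hg₂ : DifferentiableAt ℂ g₂ z) (hf₁ : DifferentiableAt ℂ f₁ z)
    (hf₂ : DifferentiableAt ℂ f₂ z) (hw : wronskian f₁ f₂ z ≠ 0)
    (h : ∀ᶠ w in 𝓝 z, g₁ w * conj (f₁ w) + g₂ w * conj (f₂ w) = 0) :
    g₁ z = 0 ∧ g₂ z = 0 := by
  have h' : ∀ᶠ w in 𝓝 z, f₁ w * conj (g₁ w) + f₂ w * conj (g₂ w) = 0 := h.mono fun w hw => by
    simpa [mul_comm] using congrArg conj hw
  have e₀ := h'.self_of_nhds
  have e₁ : deriv f₁ z * conj (g₁ z) + deriv f₂ z * conj (g₂ z) = 0 := by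
    rw [← dz_mul_conj_add hf₁ hf₂ hg₁ hg₂, dz_congr h', dz_eq_deriv (differentiableAt_const _),
      deriv_const]
  rw [wronskian] at hw
  constructor <;> refine (map_eq_zero conj).1 ((mul_eq_zero.1 ?_).resolve_right hw)
  · linear_combination deriv f₂ z * e₀ - f₂ z * e₁
  · linear_combination f₁ z * e₁ - deriv f₁ z * e₀

lemma bilinear_form_eq_zero (hf₁ : AnalyticAt ℂ f₁ z) (hf₂ : AnalyticAt ℂ f₂ z)
    (hw : wronskian f₁ f₂ z ≠ 0) {m₁₁ m₁₂ m₂₁ m₂₂ : ℂ}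
    (h : ∀ᶠ w in 𝓝 z, (m₁₁ * f₁ w + m₁₂ * f₂ w) * conj (f₁ w)
      + (m₂₁ * f₁ w + m₂₂ * f₂ w) * conj (f₂ w) = 0) :
    (m₁₁ = 0 ∧ m₁₂ = 0) ∧ m₂₁ = 0 ∧ m₂₂ = 0 := by
  have key : ∀ᶠ w in 𝓝 z, m₁₁ * f₁ w + m₁₂ * f₂ w = 0 ∧ m₂₁ * f₁ w + m₂₂ * f₂ w = 0 := by
    filter_upwards [hf₁.eventually_analyticAt, hf₂.eventually_analyticAt, h.eventually_nhds,
      (hasDerivAt_wronskian hf₁ hf₂).continuousAt.eventually_ne hw] with w h₁ h₂ hm hw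
    have d₁ := h₁.differentiableAt
    have d₂ := h₂.differentiableAt
    exact eq_zero_of_mul_conj_add_eq_zero ((d₁.const_mul m₁₁).fun_add (d₂.const_mul m₁₂))
      ((d₁.const_mul m₂₁).fun_add (d₂.const_mul m₂₂)) d₁ d₂ hw hm
  exact ⟨eq_zero_of_wronskian_ne_zero hf₁ hf₂ hw (key.mono fun _ => And.left),
    eq_zero_of_wronskian_ne_zero hf₁ hf₂ hw (key.mono fun _ => And.right)⟩

end Wirtinger

/-- The hypergeometric operator `hyperOp` with the Wirtinger derivative `∂_z` in place of the
complex derivative. -/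
def dzHyperOp (a b c : ℂ) (τ : ℂ → ℂ) (z : ℂ) : ℂ :=
  z * (1 - z) * dz (dz τ) z + (c - (a + b + 1) * z) * dz τ z - a * b * τ z

/-- The Wronskian `τ f' - (∂_z τ) f` of a real-differentiable and a holomorphic function. -/
def dzWronskian (τ f : ℂ → ℂ) (z : ℂ) : ℂ := τ z * deriv f z - dz τ z * f z

lemma ne_zero_of_mem_puncturedPlane {z : ℂ} (hz : z ∈ puncturedPlane) : z ≠ 0 :=
  fun h => hz (Or.inl h)

lemma one_sub_ne_zero_of_mem_puncturedPlane {z : ℂ} (hz : z ∈ puncturedPlane) : 1 - z ≠ 0 :=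
  fun h => hz (Or.inr (sub_eq_zero.1 h).symm)

lemma dzHyperOp_eq {τ : ℂ → ℂ} {z : ℂ} (hz : z ∈ puncturedPlane) (a b c : ℂ) :
    dzHyperOp a b c τ z = z * (1 - z) * (dz (dz τ) z
      + (c - z * (a + b + 1)) / (z * (1 - z)) * dz τ z - a * b / (z * (1 - z)) * τ z) := by
  have h0 := ne_zero_of_mem_puncturedPlane hz
  have h1 := one_sub_ne_zero_of_mem_puncturedPlane hz
  rw [dzHyperOp]
  field_simp

/-- `T` is of class `C²` at `z` and solves the equation there, with denominators cleared. -/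
def IsSolutionAt (a b c : ℝ) (T : ℂ → ℝ) (z : ℂ) : Prop :=
  ContDiffAt ℝ 2 T z ∧ dzHyperOp a b c (fun w => (T w : ℂ)) z = 0

lemma isSolution_iff {a b c : ℝ} {T : ℂ → ℝ} :
    IsSolution a b c T ↔ ∀ z ∈ puncturedPlane, IsSolutionAt a b c T z := by
  unfold IsSolution IsSolutionAt
  rw [forall₂_and, isOpen_puncturedPlane.contDiffOn_iff]
  refine and_congr Iff.rfl (forall₂_congr fun z hz => ?_)
  rw [dzHyperOp_eq hz, mul_eq_zero, or_iff_right (mul_ne_zero (ne_zero_of_mem_puncturedPlane hz)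
    (one_sub_ne_zero_of_mem_puncturedPlane hz))]

section DzHyperOp

variable {a b c : ℂ} {τ τ' f f₁ f₂ g₁ g₂ : ℂ → ℂ} {Ω : Set ℂ} {z : ℂ}

lemma dzHyperOp_congr (h : τ =ᶠ[𝓝 z] τ') : dzHyperOp a b c τ z = dzHyperOp a b c τ' z := by
  have hdz : dz τ =ᶠ[𝓝 z] dz τ' := h.eventuallyEq_nhds.mono fun _ => dz_congr
  rw [dzHyperOp, dzHyperOp, dz_congr hdz, hdz.eq_of_nhds, h.eq_of_nhds]

lemma dz_reflect (f : ℂ → ℂ) (z : ℂ) : dz (fun w => f (1 - w)) z = -dz f (1 - z) := by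
  have hcomp : (fun w => f (1 - w)) = (fun v => f (1 + v)) ∘ ContinuousLinearEquiv.neg ℝ := rfl
  rw [dz, dz, hcomp, ContinuousLinearEquiv.comp_right_fderiv, fderiv_comp_add_left]
  simp only [ContinuousLinearMap.comp_apply, ContinuousLinearEquiv.coe_coe,
    ContinuousLinearEquiv.neg_apply, map_neg, ← sub_eq_add_neg]
  ring

lemma dzHyperOp_reflect (a b c : ℂ) (f : ℂ → ℂ) (z : ℂ) :
    dzHyperOp a b c (fun w => f (1 - w)) z = dzHyperOp a b (a + b - c + 1) f (1 - z) := by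
  have hdz : dz (fun w => f (1 - w)) = fun w => -dz f (1 - w) := funext (dz_reflect f)
  have hneg : dz (fun w => -dz f (1 - w)) z = -dz (fun w => dz f (1 - w)) z := by
    unfold dz
    rw [fderiv_fun_neg]
    simp only [neg_apply]
    ring
  rw [dzHyperOp, dzHyperOp, hdz, hneg, dz_reflect]
  ring

lemma dzHyperOp_mul_conj_add (hg₁ : AnalyticAt ℂ g₁ z) (hg₂ : AnalyticAt ℂ g₂ z)
    (hf₁ : AnalyticAt ℂ f₁ z) (hf₂ : AnalyticAt ℂ f₂ z) :
    dzHyperOp a b c (fun w => g₁ w * conj (f₁ w) + g₂ w * conj (f₂ w)) z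
      = hyperOp a b c g₁ z * conj (f₁ z) + hyperOp a b c g₂ z * conj (f₂ z) := by
  have hdz : dz (fun w => g₁ w * conj (f₁ w) + g₂ w * conj (f₂ w))
      =ᶠ[𝓝 z] fun w => deriv g₁ w * conj (f₁ w) + deriv g₂ w * conj (f₂ w) := by
    filter_upwards [hg₁.eventually_analyticAt, hg₂.eventually_analyticAt,
      hf₁.eventually_analyticAt, hf₂.eventually_analyticAt] with w hg₁ hg₂ hf₁ hf₂
    exact dz_mul_conj_add hg₁.differentiableAt hg₂.differentiableAt hf₁.differentiableAt
      hf₂.differentiableAt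
  rw [dzHyperOp, dz_congr hdz, hdz.eq_of_nhds, dz_mul_conj_add hg₁.deriv.differentiableAt
    hg₂.deriv.differentiableAt hf₁.differentiableAt hf₂.differentiableAt, hyperOp, hyperOp]
  ring

lemma differentiableAt_dzWronskian (hτ : DifferentiableAt ℝ τ z)
    (hτ' : DifferentiableAt ℝ (dz τ) z) (hf : AnalyticAt ℂ f z) :
    DifferentiableAt ℝ (dzWronskian τ f) z :=
  (hτ.fun_mul (hf.deriv.differentiableAt.restrictScalars ℝ)).fun_sub
    (hτ'.fun_mul (hf.differentiableAt.restrictScalars ℝ))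

lemma mul_dz_dzWronskian (hτ : DifferentiableAt ℝ τ z) (hτ' : DifferentiableAt ℝ (dz τ) z)
    (hf : AnalyticAt ℂ f z) (hτ0 : dzHyperOp a b c τ z = 0) (hf0 : hyperOp a b c f z = 0) :
    z * (1 - z) * dz (dzWronskian τ f) z
      = -(c - (a + b + 1) * z) * dzWronskian τ f z := by
  have hf₀ := hf.differentiableAt.restrictScalars ℝ
  have hf₁ := hf.deriv.differentiableAt.restrictScalars ℝ
  have e : dz (dzWronskian τ f) z = τ z * deriv (deriv f) z - dz (dz τ) z * f z := by
    unfold dzWronskian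
    rw [dz_sub (hτ.fun_mul hf₁) (hτ'.fun_mul hf₀), dz_mul hτ hf₁, dz_mul hτ' hf₀,
      dz_eq_deriv hf.deriv.differentiableAt, dz_eq_deriv hf.differentiableAt]
    ring
  rw [dzHyperOp] at hτ0
  rw [hyperOp] at hf0
  rw [e, dzWronskian]
  linear_combination τ z * hf0 - f z * hτ0

/-- Both Wronskians satisfy the same first-order equation in `∂_z`, so their quotient is
antiholomorphic. -/
lemma differentiableAt_conj_dzWronskian_div (hz : z ∈ puncturedPlane)
    (hτ : DifferentiableAt ℝ τ z) (hτ' : DifferentiableAt ℝ (dz τ) z)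
    (hτ0 : dzHyperOp a b c τ z = 0) (hΩ : IsOpen Ω) (hzΩ : z ∈ Ω) (hf : IsHyperSol a b c f Ω)
    (h₁ : IsHyperSol a b c f₁ Ω) (h₂ : IsHyperSol a b c f₂ Ω) (hw : wronskian f₁ f₂ z ≠ 0) :
    DifferentiableAt ℂ (fun w => conj (dzWronskian τ f w * (wronskian f₁ f₂ w)⁻¹)) z := by
  have hfa := hf.analyticAt hΩ hzΩ
  have h₁a := h₁.analyticAt hΩ hzΩ
  have h₂a := h₂.analyticAt hΩ hzΩ
  have hD := differentiableAt_dzWronskian hτ hτ' hfa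
  have hW := (hasDerivAt_wronskian h₁a h₂a).differentiableAt
  have hWi := hW.hasDerivAt.fun_inv hw
  have hWi' := hWi.differentiableAt.restrictScalars ℝ
  refine differentiableAt_conj_of_dz_eq_zero (hD.fun_mul hWi') ?_
  rw [dz_mul hD hWi', dz_eq_deriv hWi.differentiableAt, hWi.deriv]
  have eD := mul_dz_dzWronskian hτ hτ' hfa hτ0 (hf.hyperOp_eq_zero z hzΩ)
  have eW := mul_deriv_wronskian h₁a h₂a (h₁.hyperOp_eq_zero z hzΩ) (h₂.hyperOp_eq_zero z hzΩ)
  refine mul_left_cancel₀ (mul_ne_zero (mul_ne_zero (ne_zero_of_mem_puncturedPlane hz)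
    (one_sub_ne_zero_of_mem_puncturedPlane hz)) (pow_ne_zero 2 hw)) ?_
  field_simp
  linear_combination wronskian f₁ f₂ z * eD - dzWronskian τ f z * eW

end DzHyperOp

section Solution

variable {a b c : ℝ} {T : ℂ → ℝ} {f₁ f₂ : ℂ → ℂ} {Ω : Set ℂ}

/-- By Cramer's rule `conj T = T` is a combination of `conj f₁` and `conj f₂` whose coefficients
are conjugated quotients of Wronskians. -/
lemma IsSolution.exists_eq_mul_conj_add (hT : IsSolution a b c T) (hΩ : IsOpen Ω)
    (hΩp : Ω ⊆ puncturedPlane) (h₁ : IsHyperSol a b c f₁ Ω) (h₂ : IsHyperSol a b c f₂ Ω)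
    (hw : ∀ z ∈ Ω, wronskian f₁ f₂ z ≠ 0) :
    ∃ g₁ g₂ : ℂ → ℂ, DifferentiableOn ℂ g₁ Ω ∧ DifferentiableOn ℂ g₂ Ω ∧
      ∀ z ∈ Ω, (T z : ℂ) = g₁ z * conj (f₁ z) + g₂ z * conj (f₂ z) := by
  set τ : ℂ → ℂ := fun w => (T w : ℂ) with hτ
  have hquot (f : ℂ → ℂ) (hf : IsHyperSol a b c f Ω) : DifferentiableOn ℂ
      (fun w => conj (dzWronskian τ f w * (wronskian f₁ f₂ w)⁻¹)) Ω := fun z hz =>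
    (differentiableAt_conj_dzWronskian_div (hΩp hz) (differentiableAt_ofReal hT.1 (hΩp hz))
      (differentiableAt_dz_ofReal hT.1 (hΩp hz)) ((isSolution_iff.1 hT z (hΩp hz)).2) hΩ hz hf
      h₁ h₂ (hw z hz)).differentiableWithinAt
  refine ⟨_, fun w => -conj (dzWronskian τ f₁ w * (wronskian f₁ f₂ w)⁻¹), hquot f₂ h₂,
    (hquot f₁ h₁).fun_neg, fun z hz => ?_⟩
  have cramer : (T z : ℂ) = dzWronskian τ f₂ z * (wronskian f₁ f₂ z)⁻¹ * f₁ z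
      - dzWronskian τ f₁ z * (wronskian f₁ f₂ z)⁻¹ * f₂ z := by
    have hwz := hw z hz
    field_simp
    rw [wronskian, dzWronskian, dzWronskian, hτ]
    ring
  rw [← Complex.conj_ofReal, cramer, map_sub, map_mul, map_mul _ (_ * _) (f₂ z)]
  ring

lemma IsSolution.exists_bilinear_form (hT : IsSolution a b c T) (hΩ : IsOpen Ω)
    (hΩc : IsPreconnected Ω) (hΩp : Ω ⊆ puncturedPlane) (h₁ : IsHyperSol a b c f₁ Ω)
    (h₂ : IsHyperSol a b c f₂ Ω) (hw : ∀ z ∈ Ω, wronskian f₁ f₂ z ≠ 0) :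
    ∃ m₁₁ m₁₂ m₂₁ m₂₂ : ℂ, ∀ z ∈ Ω, (T z : ℂ)
      = (m₁₁ * f₁ z + m₁₂ * f₂ z) * conj (f₁ z) + (m₂₁ * f₁ z + m₂₂ * f₂ z) * conj (f₂ z) := by
  obtain ⟨g₁, g₂, hg₁, hg₂, hTg⟩ := hT.exists_eq_mul_conj_add hΩ hΩp h₁ h₂ hw
  have ag₁ (z : ℂ) (hz : z ∈ Ω) := hg₁.analyticAt (hΩ.mem_nhds hz)
  have ag₂ (z : ℂ) (hz : z ∈ Ω) := hg₂.analyticAt (hΩ.mem_nhds hz)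
  have hsum (z : ℂ) (hz : z ∈ Ω) :
      hyperOp a b c g₁ z * conj (f₁ z) + hyperOp a b c g₂ z * conj (f₂ z) = 0 := by
    rw [← dzHyperOp_mul_conj_add (ag₁ z hz) (ag₂ z hz) (h₁.analyticAt hΩ hz)
      (h₂.analyticAt hΩ hz), ← (isSolution_iff.1 hT z (hΩp hz)).2]
    exact dzHyperOp_congr (eventually_of_mem (hΩ.mem_nhds hz) fun w hw => (hTg w hw).symm)
  have hzero (z : ℂ) (hz : z ∈ Ω) : hyperOp a b c g₁ z = 0 ∧ hyperOp a b c g₂ z = 0 :=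
    eq_zero_of_mul_conj_add_eq_zero (analyticAt_hyperOp a b c (ag₁ z hz)).differentiableAt
      (analyticAt_hyperOp a b c (ag₂ z hz)).differentiableAt
      (h₁.analyticAt hΩ hz).differentiableAt (h₂.analyticAt hΩ hz).differentiableAt (hw z hz)
      (eventually_of_mem (hΩ.mem_nhds hz) hsum)
  obtain ⟨m₁₁, m₁₂, hm₁⟩ := IsHyperSol.exists_eq hΩ hΩc hΩp h₁ h₂ hw
    ⟨hg₁, fun z hz => (hzero z hz).1⟩
  obtain ⟨m₂₁, m₂₂, hm₂⟩ := IsHyperSol.exists_eq hΩ hΩc hΩp h₁ h₂ hw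
    ⟨hg₂, fun z hz => (hzero z hz).2⟩
  exact ⟨m₁₁, m₁₂, m₂₁, m₂₂, fun z hz => by rw [hTg z hz, hm₁ z hz, hm₂ z hz]⟩

lemma ofReal_norm_sq_combination (l₁ l₂ : ℝ) (z w : ℂ) :
    ((l₁ * ‖z‖ ^ 2 + l₂ * ‖w‖ ^ 2 : ℝ) : ℂ) = l₁ * z * conj z + l₂ * w * conj w := by
  push_cast
  rw [mul_assoc, mul_assoc, Complex.mul_conj', Complex.mul_conj']

lemma isSolutionAt_norm_sq_combination (l₁ l₂ : ℝ) {z : ℂ} (hΩ : IsOpen Ω) (hz : z ∈ Ω)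
    (h₁ : IsHyperSol a b c f₁ Ω) (h₂ : IsHyperSol a b c f₂ Ω) :
    IsSolutionAt a b c (fun w => l₁ * ‖f₁ w‖ ^ 2 + l₂ * ‖f₂ w‖ ^ 2) z := by
  have a₁ := h₁.analyticAt hΩ hz
  have a₂ := h₂.analyticAt hΩ hz
  refine ⟨(contDiffAt_const.mul ((a₁.contDiffAt.restrict_scalars ℝ).norm_sq ℝ)).add
    (contDiffAt_const.mul ((a₂.contDiffAt.restrict_scalars ℝ).norm_sq ℝ)), ?_⟩
  have hop {f : ℂ → ℂ} (l : ℂ) (hf : hyperOp a b c f z = 0) :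
      hyperOp a b c (fun w => l * f w) z = 0 := by
    rw [hyperOp] at hf
    simp only [hyperOp, deriv_const_mul_field']
    linear_combination l * hf
  simp only [ofReal_norm_sq_combination]
  rw [dzHyperOp_mul_conj_add (g₁ := fun w => l₁ * f₁ w) (g₂ := fun w => l₂ * f₂ w)
    (analyticAt_const.mul a₁) (analyticAt_const.mul a₂) a₁ a₂,
    hop l₁ (h₁.hyperOp_eq_zero z hz), hop l₂ (h₂.hyperOp_eq_zero z hz), zero_mul, zero_mul,
    add_zero]

lemma IsSolutionAt.congr {S : ℂ → ℝ} {z : ℂ} (hS : IsSolutionAt a b c S z) (h : T =ᶠ[𝓝 z] S) :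
    IsSolutionAt a b c T z :=
  ⟨hS.1.congr_of_eventuallyEq h,
    (dzHyperOp_congr (h.mono fun _ => congrArg Complex.ofReal)).trans hS.2⟩

lemma IsSolutionAt.reflect {z : ℂ} (hT : IsSolutionAt a b (a + b - c + 1) T (1 - z)) :
    IsSolutionAt a b c (fun w => T (1 - w)) z := by
  refine ⟨hT.1.comp z (by fun_prop), ?_⟩
  rw [dzHyperOp_reflect a b c (fun w => (T w : ℂ)), ← hT.2]
  push_cast
  rfl

lemma one_sub_mem_puncturedPlane {z : ℂ} (hz : z ∈ puncturedPlane) : 1 - z ∈ puncturedPlane := by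
  rintro (h | h)
  · exact one_sub_ne_zero_of_mem_puncturedPlane hz h
  · exact ne_zero_of_mem_puncturedPlane hz (sub_eq_self.1 h)

lemma IsSolution.reflect (hT : IsSolution a b c T) :
    IsSolution a b (a + b - c + 1) (fun z => T (1 - z)) := by
  refine isSolution_iff.2 fun z hz => IsSolutionAt.reflect ?_
  rw [show a + b - (a + b - c + 1) + 1 = c by ring]
  exact isSolution_iff.1 hT _ (one_sub_mem_puncturedPlane hz)

end Solution

/-- The plane cut along `[0, ∞)`. -/
def rightCutPlane : Set ℂ := {z : ℂ | -z ∈ Complex.slitPlane}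

section RightCutPlane

variable {z : ℂ}

lemma mem_rightCutPlane_iff : z ∈ rightCutPlane ↔ z.re < 0 ∨ z.im ≠ 0 := by
  rw [rightCutPlane, Set.mem_ofPred_eq, Complex.mem_slitPlane_iff, Complex.neg_re, Complex.neg_im,
    neg_pos, neg_ne_zero]

lemma isOpen_rightCutPlane : IsOpen rightCutPlane :=
  Complex.isOpen_slitPlane.preimage continuous_neg

lemma isPreconnected_rightCutPlane : IsPreconnected rightCutPlane := by
  have himage : rightCutPlane = Neg.neg '' Complex.slitPlane := by
    rw [Set.image_neg_eq_neg]
    rfl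
  rw [himage]
  exact (Complex.starConvex_one_slitPlane.isPathConnected
    Complex.one_mem_slitPlane).isConnected.isPreconnected.image _ continuous_neg.continuousOn

lemma rightCutPlane_subset_cutPlane : rightCutPlane ⊆ cutPlane := fun _ hz hcut =>
  (mem_rightCutPlane_iff.1 hz).elim (fun h => by linarith [hcut.2]) fun h => h hcut.1

lemma rightCutPlane_subset_puncturedPlane : rightCutPlane ⊆ puncturedPlane := by
  rintro z hz (rfl | rfl) <;> norm_num [mem_rightCutPlane_iff] at hz

lemma mem_doubleCutPlane_or_mem_rightCutPlane (hz : z ∈ puncturedPlane) (hzc : z ∈ cutPlane) :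
    z ∈ doubleCutPlane ∨ z ∈ rightCutPlane := by
  by_cases hs : z ∈ Complex.slitPlane
  · exact Or.inl ⟨hzc, hs⟩
  · exact Or.inr ((Complex.mem_slitPlane_or_neg_mem_slitPlane
      (ne_zero_of_mem_puncturedPlane hz)).resolve_left hs)

end RightCutPlane

/-- The variant of `F₊` whose power has its branch cut along `[0, ∞)`. -/
def FplusNeg (a b c : ℝ) (z : ℂ) : ℂ :=
  (-z) ^ (1 - (c : ℂ)) * gauss2F1 (1 + a - c) (1 + b - c) (2 - c) z

/-- The quotient of `FplusNeg` by `F₊` in the upper half-plane, `e ^ (-π (1 - c) i)`. -/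
def monodromyFactor (c : ℝ) : ℂ := Complex.exp (-(Real.pi * (1 - c) : ℝ) * Complex.I)

section Monodromy

variable {a b c : ℝ} {z : ℂ}

lemma norm_FplusNeg (a b c : ℝ) (z : ℂ) : ‖FplusNeg a b c z‖ = ‖Fplus a b c z‖ := by
  rw [FplusNeg, Fplus, norm_mul, norm_mul, ← Complex.ofReal_one, ← Complex.ofReal_sub,
    Complex.norm_cpow_real, Complex.norm_cpow_real, norm_neg]

lemma isPowBranch_neg_cpow (p : ℂ) : IsPowBranch p (fun z => (-z) ^ p) rightCutPlane where
  zero_notMem := by simp [mem_rightCutPlane_iff]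
  ne_zero z hz := (isPowBranch_cpow p).ne_zero (-z) hz
  hasDerivAt z hz := by
    refine (((isPowBranch_cpow p).hasDerivAt (-z) hz).scomp z (hasDerivAt_neg z)).congr_deriv ?_
    rw [div_neg, smul_eq_mul, neg_mul_neg, one_mul]

lemma isHyperSol_FplusNeg (a b : ℝ) (hc : ∀ n : ℤ, c ≠ n) :
    IsHyperSol a b c (FplusNeg a b c) rightCutPlane :=
  isHyperSol_powBranch_mul_gauss2F1 a b hc isOpen_rightCutPlane rightCutPlane_subset_cutPlane
    (isPowBranch_neg_cpow _)

lemma wronskian_Fminus_FplusNeg_ne_zero (a b : ℝ) (hc : ∀ n : ℤ, c ≠ n) (hz : z ∈ rightCutPlane) :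
    wronskian (Fminus a b c) (FplusNeg a b c) z ≠ 0 :=
  wronskian_powBranch_ne_zero a b hc rightCutPlane_subset_cutPlane (isPowBranch_neg_cpow _) hz

lemma FplusNeg_of_im_pos (a b c : ℝ) (hz : 0 < z.im) :
    FplusNeg a b c z = monodromyFactor c * Fplus a b c z := by
  have h0 : z ≠ 0 := fun h => hz.ne' (h ▸ Complex.zero_im)
  rw [FplusNeg, Fplus, monodromyFactor, ← mul_assoc,
    Complex.cpow_def_of_ne_zero (neg_ne_zero.2 h0), Complex.cpow_def_of_ne_zero h0,
    ← Complex.exp_add, Complex.log, Complex.log, norm_neg,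
    Complex.arg_neg_eq_arg_sub_pi_of_im_pos hz]
  congr 2
  push_cast
  ring

lemma FplusNeg_of_im_neg (a b c : ℝ) (hz : z.im < 0) :
    FplusNeg a b c z = conj (monodromyFactor c) * Fplus a b c z := by
  have h0 : z ≠ 0 := fun h => hz.ne (h ▸ Complex.zero_im)
  rw [FplusNeg, Fplus, monodromyFactor, ← mul_assoc,
    Complex.cpow_def_of_ne_zero (neg_ne_zero.2 h0), Complex.cpow_def_of_ne_zero h0,
    ← Complex.exp_conj, ← Complex.exp_add, Complex.log, Complex.log, norm_neg,
    Complex.arg_neg_eq_arg_add_pi_of_im_neg hz]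
  congr 2
  simp only [map_mul, map_neg, Complex.conj_I, Complex.conj_ofReal]
  push_cast
  ring

lemma monodromyFactor_mul_conj (c : ℝ) : monodromyFactor c * conj (monodromyFactor c) = 1 := by
  rw [Complex.mul_conj', monodromyFactor, ← Complex.ofReal_neg, Complex.norm_exp_ofReal_mul_I,
    Complex.ofReal_one, one_pow]

lemma monodromyFactor_ne_conj (hc : ∀ n : ℤ, c ≠ n) :
    monodromyFactor c ≠ conj (monodromyFactor c) := by
  intro h
  have him : Real.sin (Real.pi * (1 - c)) = 0 := by
    have := Complex.conj_eq_iff_im.1 h.symm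
    rwa [monodromyFactor, ← Complex.ofReal_neg, Complex.exp_ofReal_mul_I_im, Real.sin_neg,
      neg_eq_zero] at this
  obtain ⟨n, hn⟩ := Real.sin_eq_zero_iff.1 him
  have hcn : (n : ℝ) = 1 - c := mul_right_cancel₀ Real.pi_ne_zero (hn.trans (mul_comm _ _))
  exact hc (1 - n) (by push_cast; linarith)

lemma bilinear_form_coeff_eq {f₁ f₂ g₂ : ℂ → ℂ} {e : ℂ} (hf₁ : AnalyticAt ℂ f₁ z)
    (hf₂ : AnalyticAt ℂ f₂ z) (hw : wronskian f₁ f₂ z ≠ 0) (hg : ∀ᶠ w in 𝓝 z, g₂ w = e * f₂ w)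
    {m₁₁ m₁₂ m₂₁ m₂₂ n₁₁ n₁₂ n₂₁ n₂₂ : ℂ}
    (hmn : ∀ᶠ w in 𝓝 z, (m₁₁ * f₁ w + m₁₂ * f₂ w) * conj (f₁ w)
        + (m₂₁ * f₁ w + m₂₂ * f₂ w) * conj (f₂ w)
      = (n₁₁ * f₁ w + n₁₂ * g₂ w) * conj (f₁ w) + (n₂₁ * f₁ w + n₂₂ * g₂ w) * conj (g₂ w)) :
    (m₁₁ = n₁₁ ∧ m₁₂ = n₁₂ * e) ∧ m₂₁ = n₂₁ * conj e ∧ m₂₂ = n₂₂ * (e * conj e) := by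
  have hzero := bilinear_form_eq_zero (m₁₁ := m₁₁ - n₁₁) (m₁₂ := m₁₂ - n₁₂ * e)
    (m₂₁ := m₂₁ - n₂₁ * conj e) (m₂₂ := m₂₂ - n₂₂ * (e * conj e)) hf₁ hf₂ hw (by
      filter_upwards [hg, hmn] with w hg hmn
      rw [hg, map_mul] at hmn
      linear_combination hmn)
  simpa only [sub_eq_zero] using hzero

lemma eq_zero_of_eq_mul_of_eq_mul {m n e e' : ℂ} (hne : e ≠ e') (h : m = n * e)
    (h' : m = n * e') : m = 0 ∧ n = 0 := by
  have hn : n = 0 := by_contra fun hn => hne (mul_left_cancel₀ hn (h.symm.trans h'))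
  exact ⟨by rw [h, hn, zero_mul], hn⟩

/-- Crossing the positive axis from above and from below multiplies the cross terms by `e` and
by `conj e ≠ e` respectively, so they vanish, whereas `|F₊|²` is multiplied by `e * conj e = 1`. -/
lemma IsSolution.exists_diagonal_form (hc : ∀ n : ℤ, c ≠ n) {T : ℂ → ℝ}
    (hT : IsSolution a b c T) :
    ∃ m₁ m₂ : ℂ, (∀ z ∈ doubleCutPlane, (T z : ℂ)
        = m₁ * Fminus a b c z * conj (Fminus a b c z) + m₂ * Fplus a b c z * conj (Fplus a b c z))
      ∧ ∀ z ∈ rightCutPlane, (T z : ℂ) = m₁ * Fminus a b c z * conj (Fminus a b c z)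
        + m₂ * FplusNeg a b c z * conj (FplusNeg a b c z) := by
  have hF := (isHyperSol_Fminus a b hc).mono doubleCutPlane_subset_cutPlane
  have hP := isHyperSol_Fplus a b hc
  obtain ⟨m₁₁, m₁₂, m₂₁, m₂₂, hm⟩ := hT.exists_bilinear_form isOpen_doubleCutPlane
    isPreconnected_doubleCutPlane doubleCutPlane_subset_puncturedPlane hF hP
    fun z hz => wronskian_Fminus_Fplus_ne_zero a b hc hz
  obtain ⟨n₁₁, n₁₂, n₂₁, n₂₂, hn⟩ := hT.exists_bilinear_form isOpen_rightCutPlane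
    isPreconnected_rightCutPlane rightCutPlane_subset_puncturedPlane
    ((isHyperSol_Fminus a b hc).mono rightCutPlane_subset_cutPlane) (isHyperSol_FplusNeg a b hc)
    fun z hz => wronskian_Fminus_FplusNeg_ne_zero a b hc hz
  have hcompare {e z : ℂ} (him : z.im ≠ 0)
      (he : ∀ᶠ w in 𝓝 z, FplusNeg a b c w = e * Fplus a b c w) :
      (m₁₁ = n₁₁ ∧ m₁₂ = n₁₂ * e) ∧ m₂₁ = n₂₁ * conj e ∧ m₂₂ = n₂₂ * (e * conj e) := by
    have hz : z ∈ doubleCutPlane := mem_doubleCutPlane_iff.2 (Or.inl him)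
    have hz' : z ∈ rightCutPlane := mem_rightCutPlane_iff.2 (Or.inr him)
    refine bilinear_form_coeff_eq (hF.analyticAt isOpen_doubleCutPlane hz)
      (hP.analyticAt isOpen_doubleCutPlane hz) (wronskian_Fminus_Fplus_ne_zero a b hc hz) he ?_
    filter_upwards [isOpen_doubleCutPlane.mem_nhds hz, isOpen_rightCutPlane.mem_nhds hz']
      with w hw hw' using (hm w hw).symm.trans (hn w hw')
  obtain ⟨⟨h₁₁, u₁₂⟩, u₂₁, h₂₂⟩ := hcompare (z := Complex.I) (by simp)
    ((Complex.continuous_im.continuousAt.eventually_const_lt (by simp)).mono fun _ =>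
      FplusNeg_of_im_pos a b c)
  obtain ⟨⟨-, l₁₂⟩, l₂₁, -⟩ := hcompare (z := -Complex.I) (by simp)
    ((Complex.continuous_im.continuousAt.eventually_lt_const (by simp)).mono fun _ =>
      FplusNeg_of_im_neg a b c)
  rw [Complex.conj_conj] at l₂₁
  have hne := monodromyFactor_ne_conj hc
  obtain ⟨hm₁₂, hn₁₂⟩ := eq_zero_of_eq_mul_of_eq_mul hne u₁₂ l₁₂
  obtain ⟨hm₂₁, hn₂₁⟩ := eq_zero_of_eq_mul_of_eq_mul hne l₂₁ u₂₁
  rw [monodromyFactor_mul_conj, mul_one] at h₂₂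
  refine ⟨m₁₁, m₂₂, fun z hz => ?_, fun z hz => ?_⟩
  · rw [hm z hz, hm₁₂, hm₂₁]
    ring
  · rw [hn z hz, hn₁₂, hn₂₁, h₁₁, h₂₂]
    ring

lemma eq_re_mul_norm_sq_add {t : ℝ} {m₁ m₂ u v : ℂ}
    (h : (t : ℂ) = m₁ * u * conj u + m₂ * v * conj v) :
    t = m₁.re * ‖u‖ ^ 2 + m₂.re * ‖v‖ ^ 2 := by
  rw [mul_assoc, mul_assoc, Complex.mul_conj, Complex.mul_conj, Complex.normSq_eq_norm_sq,
    Complex.normSq_eq_norm_sq] at h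
  simpa only [Complex.add_re, Complex.re_mul_ofReal, Complex.ofReal_re] using congrArg Complex.re h

lemma IsSolution.exists_eq_combination (hc : ∀ n : ℤ, c ≠ n) {T : ℂ → ℝ}
    (hT : IsSolution a b c T) :
    ∃ l₁ l₂ : ℝ, ∀ z ∈ puncturedPlane ∩ cutPlane, T z = combination a b c l₁ l₂ z := by
  obtain ⟨m₁, m₂, hdouble, hright⟩ := hT.exists_diagonal_form hc
  refine ⟨m₁.re, m₂.re, fun z ⟨hz, hzc⟩ => ?_⟩
  rw [combination]
  rcases mem_doubleCutPlane_or_mem_rightCutPlane hz hzc with hz | hz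
  · exact eq_re_mul_norm_sq_add (hdouble z hz)
  · rw [← norm_FplusNeg]
    exact eq_re_mul_norm_sq_add (hright z hz)

end Monodromy

section Condition

variable {a b c l₁ l₂ k₁ k₂ : ℝ} {z : ℂ}

lemma gammaRatio_mul_gammaRatio_minus (a b c : ℝ) :
    gammaRatio a b c * gammaRatio (c - a) (c - b) c
      = Real.Gamma (c - a - b) * Real.Gamma (a + b - c) * coeffMinus a b c := by
  rw [gammaRatio, gammaRatio, coeffMinus, show c - (c - a) - (c - b) = a + b - c by ring,
    sub_sub_cancel, sub_sub_cancel]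
  simp only [div_eq_mul_inv, mul_inv]
  ring

lemma gammaRatio_mul_gammaRatio_plus (a b c : ℝ) :
    gammaRatio (1 + a - c) (1 + b - c) (2 - c) * gammaRatio (1 - a) (1 - b) (2 - c)
      = Real.Gamma (c - a - b) * Real.Gamma (a + b - c) * coeffPlus a b c := by
  rw [gammaRatio, gammaRatio, coeffPlus,
    show 2 - c - (1 + a - c) - (1 + b - c) = c - a - b by ring,
    show 2 - c - (1 + a - c) = 1 - a by ring, show 2 - c - (1 + b - c) = 1 - b by ring,
    show 2 - c - (1 - a) - (1 - b) = a + b - c by ring,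
    show 2 - c - (1 - a) = a - c + 1 by ring, show 2 - c - (1 - b) = b - c + 1 by ring]
  simp only [div_eq_mul_inv, mul_inv]
  ring

lemma Gamma_mul_Gamma_ne_zero (hcab : ∀ n : ℤ, c - a - b ≠ n) :
    Real.Gamma (c - a - b) * Real.Gamma (a + b - c) ≠ 0 := by
  refine mul_ne_zero (Real.Gamma_ne_zero fun m h => hcab (-m) ?_)
    (Real.Gamma_ne_zero fun m h => hcab m ?_)
  · exact_mod_cast h
  · push_cast
    linarith

lemma ofReal_combination (a b c l₁ l₂ : ℝ) (z : ℂ) :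
    (combination a b c l₁ l₂ z : ℂ) = l₁ * Fminus a b c z * conj (Fminus a b c z)
      + l₂ * Fplus a b c z * conj (Fplus a b c z) :=
  ofReal_norm_sq_combination l₁ l₂ _ _

lemma exists_combination_eq_reflect_add (hc : ∀ n : ℤ, c ≠ n) (hcab : ∀ n : ℤ, c - a - b ≠ n)
    (l₁ l₂ : ℝ) :
    ∃ m₁ m₂ : ℝ, ∀ z ∈ doubleCutPlane, (combination a b c l₁ l₂ z : ℂ)
      = combination a b (a + b - c + 1) m₁ m₂ (1 - z)
        + (Real.Gamma (c - a - b) * Real.Gamma (a + b - c)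
            * (l₁ * coeffMinus a b c + l₂ * coeffPlus a b c) : ℝ)
          * (Fplus a b (a + b - c + 1) (1 - z) * conj (Fminus a b (a + b - c + 1) (1 - z))
            + Fminus a b (a + b - c + 1) (1 - z) * conj (Fplus a b (a + b - c + 1) (1 - z))) := by
  have hminus := congrArg Complex.ofReal (gammaRatio_mul_gammaRatio_minus a b c)
  have hplus := congrArg Complex.ofReal (gammaRatio_mul_gammaRatio_plus a b c)
  refine ⟨l₁ * gammaRatio a b c ^ 2 + l₂ * gammaRatio (1 + a - c) (1 + b - c) (2 - c) ^ 2,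
    l₁ * gammaRatio (c - a) (c - b) c ^ 2 + l₂ * gammaRatio (1 - a) (1 - b) (2 - c) ^ 2,
    fun z hz => ?_⟩
  have hF : Fminus a b c z = _ := isConnection_gammaRatio hc hcab z hz
  rw [ofReal_combination, ofReal_combination, hF, Fplus_connection hc hcab hz]
  simp only [map_add, map_mul, Complex.conj_ofReal]
  push_cast at hminus hplus ⊢
  linear_combination
    (Fplus a b (a + b - c + 1) (1 - z) * conj (Fminus a b (a + b - c + 1) (1 - z))
      + Fminus a b (a + b - c + 1) (1 - z) * conj (Fplus a b (a + b - c + 1) (1 - z)))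
    * (l₁ * hminus + l₂ * hplus)

lemma bilinear_form_Fminus_Fplus_eq_zero (hc : ∀ n : ℤ, c ≠ n) {m₁₁ m₁₂ m₂₁ m₂₂ : ℂ}
    (h : ∀ z ∈ doubleCutPlane,
      (m₁₁ * Fminus a b c z + m₁₂ * Fplus a b c z) * conj (Fminus a b c z)
        + (m₂₁ * Fminus a b c z + m₂₂ * Fplus a b c z) * conj (Fplus a b c z) = 0) :
    (m₁₁ = 0 ∧ m₁₂ = 0) ∧ m₂₁ = 0 ∧ m₂₂ = 0 :=
  bilinear_form_eq_zero
    (((isHyperSol_Fminus a b hc).mono doubleCutPlane_subset_cutPlane).analyticAt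
      isOpen_doubleCutPlane half_mem_doubleCutPlane)
    ((isHyperSol_Fplus a b hc).analyticAt isOpen_doubleCutPlane half_mem_doubleCutPlane)
    (wronskian_Fminus_Fplus_ne_zero a b hc half_mem_doubleCutPlane)
    (eventually_of_mem (isOpen_doubleCutPlane.mem_nhds half_mem_doubleCutPlane) h)

lemma combination_eq_zero (hc : ∀ n : ℤ, c ≠ n)
    (h : ∀ z ∈ doubleCutPlane, combination a b c l₁ l₂ z = 0) : l₁ = 0 ∧ l₂ = 0 := by
  obtain ⟨⟨h₁, -⟩, -, h₂⟩ := bilinear_form_Fminus_Fplus_eq_zero (a := a) (b := b) hc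
      (m₁₁ := l₁) (m₁₂ := 0) (m₂₁ := 0) (m₂₂ := l₂) fun z hz => by
    have hcomb := ofReal_combination a b c l₁ l₂ z
    rw [h z hz, Complex.ofReal_zero] at hcomb
    linear_combination -hcomb
  exact ⟨Complex.ofReal_eq_zero.1 h₁, Complex.ofReal_eq_zero.1 h₂⟩

lemma coeff_condition_of_eq_reflect (hc : ∀ n : ℤ, c ≠ n) (hcab : ∀ n : ℤ, c - a - b ≠ n)
    (h : ∀ z ∈ doubleCutPlane,
      combination a b c l₁ l₂ z = combination a b (a + b - c + 1) k₁ k₂ (1 - z)) :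
    l₁ * coeffMinus a b c + l₂ * coeffPlus a b c = 0 := by
  obtain ⟨m₁, m₂, hm⟩ := exists_combination_eq_reflect_add hc hcab l₁ l₂
  obtain ⟨⟨-, hcross⟩, -⟩ := bilinear_form_Fminus_Fplus_eq_zero (a := a) (b := b)
      (reflect_ne_intCast hcab) (m₁₁ := m₁ - k₁) (m₂₂ := m₂ - k₂)
      (m₁₂ := (Real.Gamma (c - a - b) * Real.Gamma (a + b - c)
        * (l₁ * coeffMinus a b c + l₂ * coeffPlus a b c) : ℝ))
      (m₂₁ := (Real.Gamma (c - a - b) * Real.Gamma (a + b - c)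
        * (l₁ * coeffMinus a b c + l₂ * coeffPlus a b c) : ℝ)) fun z hz => by
    have hz' := one_sub_mem_doubleCutPlane hz
    have heq := hm _ hz'
    rw [h _ hz', sub_sub_cancel, ofReal_combination, ofReal_combination] at heq
    linear_combination -heq
  exact (mul_eq_zero.1 (Complex.ofReal_eq_zero.1 hcross)).resolve_left
    (Gamma_mul_Gamma_ne_zero hcab)

lemma exists_eq_reflect_of_coeff_condition (hc : ∀ n : ℤ, c ≠ n) (hcab : ∀ n : ℤ, c - a - b ≠ n)
    (h : l₁ * coeffMinus a b c + l₂ * coeffPlus a b c = 0) :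
    ∃ k₁ k₂ : ℝ, ∀ z ∈ doubleCutPlane,
      combination a b c l₁ l₂ z = combination a b (a + b - c + 1) k₁ k₂ (1 - z) := by
  obtain ⟨m₁, m₂, hm⟩ := exists_combination_eq_reflect_add hc hcab l₁ l₂
  refine ⟨m₁, m₂, fun z hz => Complex.ofReal_injective ?_⟩
  rw [hm z hz, h, mul_zero, Complex.ofReal_zero, zero_mul, add_zero]

end Condition

section Solutions

variable {a b c l₁ l₂ k₁ k₂ : ℝ} {S T : ℂ → ℝ} {z : ℂ}

lemma ofReal_mem_puncturedPlane {x : ℝ} (hx : 1 < x) : (x : ℂ) ∈ puncturedPlane := by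
  rintro (h | h)
  · linarith [Complex.ofReal_eq_zero.1 h]
  · exact hx.ne' (Complex.ofReal_eq_one.1 h)

lemma IsSolution.hasForm (hT : IsSolution a b c T)
    (h : ∀ z ∈ puncturedPlane ∩ cutPlane, T z = combination a b c l₁ l₂ z) :
    HasForm a b c l₁ l₂ T := by
  refine ⟨h, fun x hx => ?_⟩
  have hn := isOpen_puncturedPlane.mem_nhds (ofReal_mem_puncturedPlane hx)
  have hcont : Tendsto T (𝓝 (x : ℂ)) (𝓝 (T x)) := hT.1.continuousOn.continuousAt hn
  refine (hcont.mono_left nhdsWithin_le_nhds).congr' ?_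
  filter_upwards [self_mem_nhdsWithin, mem_nhdsWithin_of_mem_nhds hn] with z hz hzp
  exact h z ⟨hzp, hz⟩

lemma IsSolution.exists_hasForm (hc : ∀ n : ℤ, c ≠ n) (hcab : ∀ n : ℤ, c - a - b ≠ n)
    (hT : IsSolution a b c T) :
    ∃ l₁ l₂ : ℝ, HasForm a b c l₁ l₂ T ∧ l₁ * coeffMinus a b c + l₂ * coeffPlus a b c = 0 := by
  obtain ⟨l₁, l₂, hl⟩ := hT.exists_eq_combination hc
  obtain ⟨k₁, k₂, hk⟩ := hT.reflect.exists_eq_combination (reflect_ne_intCast hcab)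
  have hsub : doubleCutPlane ⊆ puncturedPlane ∩ cutPlane :=
    Set.subset_inter doubleCutPlane_subset_puncturedPlane doubleCutPlane_subset_cutPlane
  refine ⟨l₁, l₂, hT.hasForm hl,
    coeff_condition_of_eq_reflect (k₁ := k₁) (k₂ := k₂) hc hcab fun z hz => ?_⟩
  rw [← hl z (hsub hz), ← hk _ (hsub (one_sub_mem_doubleCutPlane hz)), sub_sub_cancel]

lemma isSolutionAt_combination (hc : ∀ n : ℤ, c ≠ n) (l₁ l₂ : ℝ) (hz : z ∈ puncturedPlane)
    (hzc : z ∈ cutPlane) : IsSolutionAt a b c (combination a b c l₁ l₂) z := by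
  rcases mem_doubleCutPlane_or_mem_rightCutPlane hz hzc with hz | hz
  · exact isSolutionAt_norm_sq_combination l₁ l₂ isOpen_doubleCutPlane hz
      ((isHyperSol_Fminus a b hc).mono doubleCutPlane_subset_cutPlane) (isHyperSol_Fplus a b hc)
  · have hsol := isSolutionAt_norm_sq_combination l₁ l₂ isOpen_rightCutPlane hz
      ((isHyperSol_Fminus a b hc).mono rightCutPlane_subset_cutPlane) (isHyperSol_FplusNeg a b hc)
    simp only [norm_FplusNeg] at hsol
    exact hsol

lemma one_sub_mem_rightCutPlane (hz : z ∈ puncturedPlane) (hzc : z ∉ cutPlane) :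
    1 - z ∈ rightCutPlane := by
  obtain ⟨him, hre⟩ := not_not.1 hzc
  have hre' : z.re ≠ 1 := fun h => hz (Or.inr (Complex.ext h him))
  rw [mem_rightCutPlane_iff, Complex.sub_re, Complex.one_re, sub_neg]
  exact Or.inl (lt_of_le_of_ne hre hre'.symm)

lemma mem_doubleCutPlane_of_one_sub_mem_rightCutPlane (hz : 1 - z ∈ rightCutPlane)
    (hzc : z ∈ cutPlane) : z ∈ doubleCutPlane := by
  refine ⟨hzc, Complex.mem_slitPlane_iff.2 ((mem_rightCutPlane_iff.1 hz).imp (fun h => ?_) ?_)⟩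
  · rw [Complex.sub_re, Complex.one_re] at h
    linarith
  · simp

/-- The two expressions `combination … z` and `combination … (1 - z)` agree on the double cut
plane; the first one extends across `(-∞, 0)` and the second one across `(1, ∞)`. -/
lemma exists_isSolution_hasForm (hc : ∀ n : ℤ, c ≠ n) (hcab : ∀ n : ℤ, c - a - b ≠ n)
    (h : l₁ * coeffMinus a b c + l₂ * coeffPlus a b c = 0) :
    ∃ T, IsSolution a b c T ∧ HasForm a b c l₁ l₂ T := by
  classical
  obtain ⟨k₁, k₂, hk⟩ := exists_eq_reflect_of_coeff_condition hc hcab h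
  let T : ℂ → ℝ := fun z => if z ∈ cutPlane then combination a b c l₁ l₂ z
    else combination a b (a + b - c + 1) k₁ k₂ (1 - z)
  have hcut : ∀ z ∈ cutPlane, T z = combination a b c l₁ l₂ z := fun z hz => if_pos hz
  have hreflect : ∀ z ∈ {z | 1 - z ∈ rightCutPlane},
      T z = combination a b (a + b - c + 1) k₁ k₂ (1 - z) := fun z hz => by
    by_cases hzc : z ∈ cutPlane
    · rw [hcut z hzc, hk z (mem_doubleCutPlane_of_one_sub_mem_rightCutPlane hz hzc)]
    · exact if_neg hzc
  have hT : IsSolution a b c T := isSolution_iff.2 fun z hz => by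
    by_cases hzc : z ∈ cutPlane
    · exact (isSolutionAt_combination hc l₁ l₂ hz hzc).congr
        (eventually_of_mem (isOpen_cutPlane.mem_nhds hzc) hcut)
    · have hz' := one_sub_mem_rightCutPlane hz hzc
      have hopen : IsOpen {z : ℂ | 1 - z ∈ rightCutPlane} :=
        isOpen_rightCutPlane.preimage (continuous_const.sub continuous_id)
      exact (isSolutionAt_combination (reflect_ne_intCast hcab) k₁ k₂
        (one_sub_mem_puncturedPlane hz) (rightCutPlane_subset_cutPlane hz')).reflect.congr
          (eventually_of_mem (hopen.mem_nhds hz') hreflect)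
  exact ⟨T, hT, hT.hasForm fun z hz => hcut z hz.2⟩

lemma neBot_nhdsWithin_cutPlane (x : ℝ) : (𝓝[cutPlane] (x : ℂ)).NeBot := by
  have hlim : Tendsto (fun y : ℝ => (x : ℂ) + y * Complex.I) (𝓝[≠] 0) (𝓝[cutPlane] (x : ℂ)) := by
    refine tendsto_nhdsWithin_iff.2 ⟨?_, ?_⟩
    · have hcont : Continuous fun y : ℝ => (x : ℂ) + y * Complex.I := by fun_prop
      exact (hcont.tendsto' 0 x (by simp)).mono_left nhdsWithin_le_nhds
    · filter_upwards [self_mem_nhdsWithin] with y hy hcut using hy (by simpa using hcut.1)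
  exact hlim.neBot

lemma HasForm.eqOn (hS : HasForm a b c l₁ l₂ S) (hT : HasForm a b c l₁ l₂ T) :
    Set.EqOn S T puncturedPlane := by
  intro z hz
  by_cases hzc : z ∈ cutPlane
  · rw [hS.1 z ⟨hz, hzc⟩, hT.1 z ⟨hz, hzc⟩]
  · obtain ⟨him, hre⟩ : z.im = 0 ∧ 1 ≤ z.re := not_not.1 hzc
    have hzx : z = (z.re : ℂ) := Complex.ext rfl him
    have hx : 1 < z.re := lt_of_le_of_ne hre fun h => hz (Or.inr (Complex.ext h.symm him))
    have := neBot_nhdsWithin_cutPlane z.re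
    rw [hzx]
    exact tendsto_nhds_unique (hS.2 z.re hx) (hT.2 z.re hx)

lemma HasForm.const_mul (hT : HasForm a b c l₁ l₂ T) (t : ℝ) :
    HasForm a b c (t * l₁) (t * l₂) (fun z => t * T z) := by
  have hcomb : combination a b c (t * l₁) (t * l₂) = fun z => t * combination a b c l₁ l₂ z := by
    funext z
    rw [combination, combination]
    ring
  rw [HasForm, hcomb]
  exact ⟨fun z hz => congrArg (t * ·) (hT.1 z hz), fun x hx => (hT.2 x hx).const_mul t⟩

lemma exists_eq_mul_of_mul_add_mul_eq_zero {p q : ℝ} (hpq : p ≠ 0 ∨ q ≠ 0)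
    (h : l₁ * p + l₂ * q = 0) : ∃ t, l₁ = t * q ∧ l₂ = t * -p := by
  rcases hpq with hp | hq
  · refine ⟨-l₂ / p, ?_, by field_simp⟩
    field_simp
    linarith
  · refine ⟨l₁ / q, by field_simp, ?_⟩
    field_simp
    linarith

lemma finrank_solutionSpace (hc : ∀ n : ℤ, c ≠ n) (hcab : ∀ n : ℤ, c - a - b ≠ n)
    (h : coeffMinus a b c ≠ 0 ∨ coeffPlus a b c ≠ 0) :
    Module.finrank ℝ (solutionSpace a b c) = 1 := by
  obtain ⟨T₀, hT₀, hF₀⟩ := exists_isSolution_hasForm hc hcab (l₁ := coeffPlus a b c)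
    (l₂ := -coeffMinus a b c) (by ring)
  refine finrank_eq_one_iff'.2 ⟨⟨fun z => T₀ z, T₀, hT₀, fun _ => rfl⟩, fun h₀ => ?_, ?_⟩
  · obtain ⟨hplus, hminus⟩ := combination_eq_zero hc fun z hz => by
      have hzp := doubleCutPlane_subset_puncturedPlane hz
      rw [← hF₀.1 z ⟨hzp, doubleCutPlane_subset_cutPlane hz⟩]
      exact congrFun (congrArg Subtype.val h₀) ⟨z, hzp⟩
    exact h.elim (fun h => h (neg_eq_zero.1 hminus)) fun h => h hplus
  · rintro ⟨u, T, hT, hu⟩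
    obtain ⟨l₁, l₂, hF, hl⟩ := hT.exists_hasForm hc hcab
    obtain ⟨t, rfl, rfl⟩ := exists_eq_mul_of_mul_add_mul_eq_zero h hl
    refine ⟨t, Subtype.ext (funext fun z => ?_)⟩
    exact ((hF₀.const_mul t).eqOn hF z.2).trans (hu z).symm

end Solutions

end

end HypergeoPDE

theorem lemma4p4 (a b c : ℝ) (hc : ∀ n : ℤ, c ≠ n) (hcab : ∀ n : ℤ, c - a - b ≠ n) :
    (∀ T : ℂ → ℝ, HypergeoPDE.IsSolution a b c T →
      ∃ l₁ l₂ : ℝ, HypergeoPDE.HasForm a b c l₁ l₂ T ∧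
        l₁ * HypergeoPDE.coeffMinus a b c + l₂ * HypergeoPDE.coeffPlus a b c = 0) ∧
    ((HypergeoPDE.coeffMinus a b c ≠ 0 ∨ HypergeoPDE.coeffPlus a b c ≠ 0) →
      Module.finrank ℝ (HypergeoPDE.solutionSpace a b c) = 1) :=
  ⟨fun _ hT => hT.exists_hasForm hc hcab, HypergeoPDE.finrank_solutionSpace hc hcab⟩
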